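/- For $b\in\mathbb R$, $p>1$ and real-valued $\phi\in H^2(\mathbb R)$ put $$I[\phi]=\frac12\int_{\mathbb R}\big(|\phi''(x)|^2-b|\phi'(x)|^2\big)\,dx-\frac1{p+1}\int_{\mathbb R}|\phi(x)|^{p+1}\,dx .$$ Let $b\in\mathbb R$ and $p\in(1,9)$. There is a number $\lambda_{b,p}\ge 0$, with $\lambda_{b,p}=0$ if $p<5$, such that for every $\lambda>\lambda_{b,p}$ the following holds. The problem of minimizing $I[\phi]$ over all real-valued $\phi\in H^2(\mathbb R)$ with $\int_{\mathbb R}\phi^2\,dx=\lambda$ has a solution $\phi_\lambda\in H^4(\mathbb R)$, and there is $\omega=\omega(b,\lambda,\phi_\lambda)\in\mathbb R$ such that $\phi_\lambda$ is of class $C^4$ and satisfies the Euler--Lagrange equation $$\phi_\lambda''''+b\,\phi_\lambda''+\omega\,\phi_\lambda-|\phi_\lambda|^{p-1}\phi_\lambda=0$$ at every point of $\mathbb R$. Moreover $\omega>b^2/4$ if $b>0$, and $\omega>0$ if $b<0$. -/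

import Mathlib

noncomputable section

namespace Kawahara

open MeasureTheory

/-- `g` is a weak (distributional) derivative of `f` on the real line. -/
def IsWeakDeriv (f g : ℝ → ℝ) : Prop :=
  LocallyIntegrable f ∧ LocallyIntegrable g ∧
    ∀ η : ℝ → ℝ, ContDiff ℝ (⊤ : ℕ∞) η → HasCompactSupport η →
      ∫ x, f x * deriv η x = -∫ x, g x * η x

/-- Weak derivatives are unique up to null sets. -/
theorem IsWeakDeriv.ae_eq {f g h : ℝ → ℝ} (hg : IsWeakDeriv f g) (hh : IsWeakDeriv f h) :
    g =ᵐ[volume] h := by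
  refine ae_eq_of_integral_contDiff_smul_eq hg.2.1 hh.2.1 fun η hη hc => ?_
  have h1 := hg.2.2 η hη hc
  have h2 := hh.2.2 η hη hc
  simp only [smul_eq_mul, mul_comm (η _)]
  linarith

open Classical in
/-- The weak derivative of `f` (a representative, unique up to null sets),
and `0` if `f` has none. -/
def weakDeriv (f : ℝ → ℝ) : ℝ → ℝ :=
  if h : ∃ g, IsWeakDeriv f g then h.choose else 0

theorem weakDeriv_spec {f g : ℝ → ℝ} (h : IsWeakDeriv f g) : IsWeakDeriv f (weakDeriv f) := by
  have h' : ∃ g, IsWeakDeriv f g := ⟨g, h⟩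
  rw [weakDeriv, dif_pos h']
  exact h'.choose_spec

/-- The real-valued Sobolev space `H^k(ℝ)`: `f` and its weak derivatives up to order `k`
are square integrable. -/
def MemH : ℕ → (ℝ → ℝ) → Prop
  | 0, f => MemLp f 2
  | k + 1, f => MemLp f 2 ∧ ∃ g, IsWeakDeriv f g ∧ MemH k g

/-- The energy `½ ∫ (|φ''|² - b |φ'|²) - (1/(p+1)) ∫ |φ|^(p+1)`. -/
def energy (b p : ℝ) (φ : ℝ → ℝ) : ℝ :=
  (1 / 2) * (∫ x, (|weakDeriv (weakDeriv φ) x| ^ 2 - b * |weakDeriv φ x| ^ 2))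
    - (1 / (p + 1)) * ∫ x, |φ x| ^ (p + 1)

/-- The constraint set `{φ ∈ H²(ℝ) : ‖φ‖²_{L²} = lam}`. -/
def massSphere (lam : ℝ) : Set (ℝ → ℝ) :=
  {φ | MemH 2 φ ∧ ∫ x, φ x ^ 2 = lam}

/-- `φ` is a classical (`C⁴`) solution of `φ'''' + b φ'' + ω φ - |φ|^(p-1) φ = 0`. -/
def IsClassicalSolution (b p ω : ℝ) (φ : ℝ → ℝ) : Prop :=
  ContDiff ℝ 4 φ ∧
    ∀ x, iteratedDeriv 4 φ x + b * iteratedDeriv 2 φ x + ω * φ x - |φ x| ^ (p - 1) * φ x = 0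

end Kawahara

end

noncomputable section

namespace Kawahara

open MeasureTheory Set Filter Topology

/-! The proof is the direct method, with a scaling argument in place of general concentration
compactness. On the mass sphere the energy may be shifted by a constant so that its quadratic part
has symbol `ξ⁴ - bξ² + b₊²/4 = (ξ² - b₊/2)² + b₋ξ² ≥ 0` (`quadForm_eq`). The interpolation bound
`‖f‖∞⁸ ≤ 16 ‖f‖₂⁶ ‖f''‖₂²` controls the nonlinear term by a multiple of `‖f''‖₂^((p-1)/4)`; this
exponent is below `2` exactly when `p < 9`, whence coercivity (`exists_coercivity`).

The infimum `m` of the shifted energy is negative above a threshold mass (`exists_threshold`). Waves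
oscillating at a minimum of the symbol, with an envelope of width `1/ε`, have quadratic energy of
order `ε²` and nonlinear energy of order `ε^((p-1)/2)` at fixed mass. The latter wins for small `ε`
if `p < 5`, and for large mass otherwise.

Negativity of `m` prevents vanishing: along a minimizing sequence the sup norm stays away from `0`,
so after translation the weak limit `f` is nonzero. The energy splits asymptotically between `f` and
the remainder. By scaling, a function of mass `β ≤ lam` has energy at least `(β/lam) m`, strictly if
it is nonzero and `β < lam`. Hence no mass is lost and `f` is a minimizer (`exists_minimizer`).

The multiplier is `ω = b₊²/4 + (N - T)/lam`, with `N` the power integral and `T` the quadratic form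
at `f`. Negative energy gives `T/2 < N/(p+1) ≤ N/2`, so `N > T`; this is the lower bound on `ω`. The
weak equation expresses `f''''` through `f` and `f''`, and integrating back gives `H⁴` and `C⁴`
regularity. -/

/-! ### Calculus of primitives of locally integrable functions -/

/-- `F` is a primitive of the locally integrable function `f`. -/
def IsPrimitive (F f : ℝ → ℝ) : Prop :=
  LocallyIntegrable f ∧ ∀ x y, F y - F x = ∫ t in x..y, f t

theorem _root_.MeasureTheory.LocallyIntegrable.intervalIntegrable {f : ℝ → ℝ}
    (hf : LocallyIntegrable f) (a b : ℝ) : IntervalIntegrable f volume a b :=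
  intervalIntegrable_iff.mpr <|
    (hf.integrableOn_isCompact isCompact_uIcc).mono_set uIoc_subset_uIcc

theorem isPrimitive_integral {f : ℝ → ℝ} (hf : LocallyIntegrable f) (a c : ℝ) :
    IsPrimitive (fun x => c + ∫ t in a..x, f t) f := by
  refine ⟨hf, fun x y => ?_⟩
  have := intervalIntegral.integral_interval_sub_left (hf.intervalIntegrable a y)
    (hf.intervalIntegrable a x)
  linarith

namespace IsPrimitive

variable {F G f g : ℝ → ℝ}

theorem eq_integral (h : IsPrimitive F f) (a : ℝ) : F = fun x => F a + ∫ t in a..x, f t := by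
  funext x
  have := h.2 a x
  linarith

theorem ac (h : IsPrimitive F f) (a b : ℝ) : AbsolutelyContinuousOnInterval F a b := by
  have h1 := (h.1.intervalIntegrable a b).absolutelyContinuousOnInterval_intervalIntegral
    (c := a) (by simp)
  rw [h.eq_integral a]
  have h2 : AbsolutelyContinuousOnInterval (fun _ : ℝ => F a) a b :=
    ((LipschitzWith.const (F a)).lipschitzOnWith (s := uIcc a b)).absolutelyContinuousOnInterval
  exact h2.add h1

theorem continuous (h : IsPrimitive F f) : Continuous F := by
  rw [h.eq_integral 0]
  exact continuous_const.add (intervalIntegral.continuous_primitive h.1.intervalIntegrable 0)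

theorem ae_hasDerivAt (h : IsPrimitive F f) : ∀ᵐ x, HasDerivAt F (f x) x := by
  filter_upwards [LocallyIntegrable.ae_hasDerivAt_integral h.1] with x hx
  rw [h.eq_integral 0]
  exact (hx 0).const_add _

theorem hasDerivAt (h : IsPrimitive F f) (hf : Continuous f) (x : ℝ) : HasDerivAt F (f x) x := by
  rw [h.eq_integral 0]
  exact (intervalIntegral.integral_hasDerivAt_right (hf.intervalIntegrable _ _)
    hf.aestronglyMeasurable.stronglyMeasurableAtFilter hf.continuousAt).const_add _

theorem of_hasDerivAt (hf : Continuous f) (h : ∀ x, HasDerivAt F (f x) x) : IsPrimitive F f :=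
  ⟨hf.locallyIntegrable, fun _ _ => (intervalIntegral.integral_eq_sub_of_hasDerivAt
    (fun t _ => h t) (hf.intervalIntegrable _ _)).symm⟩

theorem congr_ae (h : IsPrimitive F f) (hfg : f =ᵐ[volume] g) : IsPrimitive F g := by
  refine ⟨h.1.congr hfg, fun x y => ?_⟩
  rw [h.2 x y]
  exact intervalIntegral.integral_congr_ae (hfg.mono fun t ht _ => ht)

theorem add (hF : IsPrimitive F f) (hG : IsPrimitive G g) :
    IsPrimitive (fun x => F x + G x) (fun x => f x + g x) := by
  refine ⟨hF.1.add hG.1, fun x y => ?_⟩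
  rw [intervalIntegral.integral_add (hF.1.intervalIntegrable _ _) (hG.1.intervalIntegrable _ _),
    ← hF.2, ← hG.2]
  ring

theorem const_mul (c : ℝ) (hF : IsPrimitive F f) :
    IsPrimitive (fun x => c * F x) (fun x => c * f x) := by
  refine ⟨hF.1.smul c, fun x y => ?_⟩
  rw [intervalIntegral.integral_const_mul, ← hF.2]
  ring

theorem comp_add_right (hF : IsPrimitive F f) (c : ℝ) :
    IsPrimitive (fun x => F (x + c)) (fun x => f (x + c)) := by
  have h1 : LocallyIntegrable (fun x => f (x + c)) := by
    have := hF.1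
    rw [locallyIntegrable_iff] at this ⊢
    intro K hK
    have h2 := this _ (hK.image (continuous_add_const c))
    have h3 := (measurePreserving_add_right volume c).integrableOn_comp_preimage
      (MeasurableEquiv.addRight c).measurableEmbedding (f := f) (s := (fun x => x + c) '' K)
    rw [preimage_image_eq _ (add_left_injective c)] at h3
    exact h3.2 h2
  refine ⟨h1, fun x y => ?_⟩
  rw [intervalIntegral.integral_comp_add_right, ← hF.2]

theorem locallyIntegrable_mul_add (hF : IsPrimitive F f) (hG : IsPrimitive G g) :
    LocallyIntegrable (fun x => f x * G x + F x * g x) := by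
  refine LocallyIntegrable.add ?_ ?_
  · rw [← locallyIntegrableOn_univ]
    exact (locallyIntegrableOn_univ.2 hF.1).mul_continuousOn hG.continuous.continuousOn
      isOpen_univ.isLocallyClosed
  · rw [← locallyIntegrableOn_univ]
    exact (locallyIntegrableOn_univ.2 hG.1).continuousOn_mul hF.continuous.continuousOn
      isOpen_univ.isLocallyClosed

theorem mul (hF : IsPrimitive F f) (hG : IsPrimitive G g) :
    IsPrimitive (fun x => F x * G x) (fun x => f x * G x + F x * g x) := by
  refine ⟨hF.locallyIntegrable_mul_add hG, fun x y => ?_⟩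
  rw [← (hF.ac x y).integral_deriv_mul_eq_sub (hG.ac x y)]
  apply intervalIntegral.integral_congr_ae
  filter_upwards [hF.ae_hasDerivAt, hG.ae_hasDerivAt] with t h1 h2 _
  rw [h1.deriv, h2.deriv]

/-- Integrability of `f` yields a limit at infinity, and a nonzero limit would contradict
integrability of `F`. -/
theorem tendsto_atTop (hF : IsPrimitive F f) (iF : Integrable F) (if' : Integrable f) :
    Tendsto F atTop (𝓝 0) := by
  have h1 : Tendsto F atTop (𝓝 (F 0 + ∫ t in Ioi 0, f t)) := by
    rw [hF.eq_integral 0]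
    simpa using (intervalIntegral_tendsto_integral_Ioi 0 if'.integrableOn tendsto_id).const_add
      (F 0)
  have h2 : IntegrableAtFilter F atTop := ⟨univ, univ_mem, iF.integrableOn⟩
  rwa [h2.eq_zero_of_tendsto (fun s hs => ?_) h1] at h1
  rcases mem_atTop_sets.1 hs with ⟨b, hb⟩
  rw [← top_le_iff, ← Real.volume_Ici (a := b)]
  exact measure_mono hb

theorem tendsto_atBot (hF : IsPrimitive F f) (iF : Integrable F) (if' : Integrable f) :
    Tendsto F atBot (𝓝 0) := by
  have h1 : Tendsto F atBot (𝓝 (F 0 - ∫ t in Iic 0, f t)) := by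
    have := (intervalIntegral_tendsto_integral_Iic 0 if'.integrableOn tendsto_id).const_sub
      (F 0)
    refine this.congr fun x => ?_
    have := hF.2 x 0
    simp only [id]
    linarith
  have h2 : IntegrableAtFilter F atBot := ⟨univ, univ_mem, iF.integrableOn⟩
  rwa [h2.eq_zero_of_tendsto (fun s hs => ?_) h1] at h1
  rcases mem_atBot_sets.1 hs with ⟨b, hb⟩
  rw [← top_le_iff, ← Real.volume_Iic (a := b)]
  exact measure_mono hb

/-- Applied to products, this is integration by parts on the whole line without boundary terms. -/
theorem integral_eq_zero (hF : IsPrimitive F f) (iF : Integrable F) (if' : Integrable f) :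
    ∫ x, f x = 0 := by
  have h1 := intervalIntegral_tendsto_integral if' tendsto_neg_atTop_atBot tendsto_id
  have h2 : Tendsto (fun x => F x - F (-x)) atTop (𝓝 (0 - 0)) :=
    (hF.tendsto_atTop iF if').sub ((hF.tendsto_atBot iF if').comp tendsto_neg_atTop_atBot)
  rw [sub_zero] at h2
  refine tendsto_nhds_unique h1 (h2.congr fun x => ?_)
  rw [hF.2]
  rfl

theorem isWeakDeriv (hF : IsPrimitive F f) : IsWeakDeriv F f := by
  refine ⟨hF.continuous.locallyIntegrable, hF.1, fun η hη hc => ?_⟩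
  have hη1 : IsPrimitive η (deriv η) := of_hasDerivAt (hη.continuous_deriv (by simp))
    fun x => (hη.differentiable (by simp) x).hasDerivAt
  have hcd : HasCompactSupport (deriv η) := hc.deriv
  have i1 : Integrable (fun x => f x * η x) := by
    simpa [mul_comm] using hF.1.integrable_smul_left_of_hasCompactSupport hη.continuous hc
  have i2 : Integrable (fun x => F x * deriv η x) :=
    (hF.continuous.mul (hη.continuous_deriv (by simp))).integrable_of_hasCompactSupport
      hcd.mul_left
  have i3 : Integrable (fun x => F x * η x) :=
    (hF.continuous.mul hη.continuous).integrable_of_hasCompactSupport hc.mul_left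
  have := (hF.mul hη1).integral_eq_zero i3 (i1.add i2)
  rw [integral_add i1 i2] at this
  linarith

end IsPrimitive

/-! ### Weak derivatives as derivatives of primitives -/

/-- A test function of integral zero is the derivative of a test function. -/
theorem exists_deriv_eq_of_integral_eq_zero {ψ : ℝ → ℝ} (hψ : ContDiff ℝ (⊤ : ℕ∞) ψ)
    (hc : HasCompactSupport ψ) (h0 : ∫ x, ψ x = 0) :
    ∃ η : ℝ → ℝ, ContDiff ℝ (⊤ : ℕ∞) η ∧ HasCompactSupport η ∧ deriv η = ψ := by
  obtain ⟨R, hR⟩ := hc.isCompact.isBounded.subset_closedBall 0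
  have hz : ∀ x, R < |x| → ψ x = 0 := fun x hx => by
    by_contra h
    have := hR (subset_tsupport _ h)
    simp at this
    linarith
  have hd : ∀ x, HasDerivAt (fun x => ∫ t in (-R - 1)..x, ψ t) (ψ x) x := fun x =>
    intervalIntegral.integral_hasDerivAt_right (hψ.continuous.intervalIntegrable _ _)
      hψ.continuous.aestronglyMeasurable.stronglyMeasurableAtFilter hψ.continuous.continuousAt
  have hde : deriv (fun x => ∫ t in (-R - 1)..x, ψ t) = ψ := funext fun x => (hd x).deriv
  refine ⟨fun x => ∫ t in (-R - 1)..x, ψ t, ?_, ?_, hde⟩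
  · rw [contDiff_infty_iff_deriv]
    exact ⟨fun x => (hd x).differentiableAt, by rwa [hde]⟩
  · refine HasCompactSupport.intro (isCompact_closedBall (0 : ℝ) (R + 1)) fun x hx => ?_
    have hx' : R + 1 < |x| := by simpa using hx
    rcases lt_abs.1 hx' with h | h
    · rw [intervalIntegral.integral_eq_integral_of_support_subset, h0]
      intro t ht
      have := abs_le.1 (not_lt.1 fun h' => ht (hz t h'))
      exact ⟨by linarith, by linarith⟩
    · rw [intervalIntegral.integral_zero_ae]
      filter_upwards with t ht
      apply hz
      rw [uIoc_of_ge (by linarith)] at ht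
      exact lt_abs.2 (Or.inr (by linarith [ht.2]))

theorem exists_test_integral_eq_one :
    ∃ χ : ℝ → ℝ, ContDiff ℝ (⊤ : ℕ∞) χ ∧ HasCompactSupport χ ∧ ∫ x, χ x = 1 := by
  let B : ContDiffBump (0 : ℝ) := ⟨1, 2, by norm_num, by norm_num⟩
  exact ⟨B.normed volume, B.contDiff_normed, B.hasCompactSupport_normed, B.integral_normed⟩

/-- Every test function is, up to a multiple of a fixed test function of integral one, the
derivative of a test function. -/
theorem exists_deriv_eq_sub {χ ψ : ℝ → ℝ} (hχ : ContDiff ℝ (⊤ : ℕ∞) χ) (hχc : HasCompactSupport χ)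
    (hχ1 : ∫ x, χ x = 1) (hψ : ContDiff ℝ (⊤ : ℕ∞) ψ) (hψc : HasCompactSupport ψ) :
    ∃ η : ℝ → ℝ, ContDiff ℝ (⊤ : ℕ∞) η ∧ HasCompactSupport η ∧
      deriv η = fun x => ψ x - (∫ y, ψ y) * χ x := by
  have iψ : Integrable ψ := hψ.continuous.integrable_of_hasCompactSupport hψc
  have iχ : Integrable χ := hχ.continuous.integrable_of_hasCompactSupport hχc
  refine exists_deriv_eq_of_integral_eq_zero (hψ.sub (contDiff_const.mul hχ))
    (hψc.sub hχc.mul_left) ?_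
  rw [integral_sub iψ (iχ.const_mul _), integral_const_mul, hχ1]
  ring

theorem integrable_mul_test {u θ : ℝ → ℝ} (hu : LocallyIntegrable u) (hθ : Continuous θ)
    (hc : HasCompactSupport θ) : Integrable (fun x => u x * θ x) := by
  simpa [mul_comm] using hu.integrable_smul_left_of_hasCompactSupport hθ hc

/-- A weakly differentiable function agrees almost everywhere with a primitive of its weak
derivative. -/
theorem IsWeakDeriv.exists_isPrimitive {f g : ℝ → ℝ} (h : IsWeakDeriv f g) :
    ∃ F, IsPrimitive F g ∧ F =ᵐ[volume] f := by
  obtain ⟨χ, hχ, hχc, hχ1⟩ := exists_test_integral_eq_one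
  have hG := isPrimitive_integral h.2.1 0 0
  set G : ℝ → ℝ := fun x => 0 + ∫ t in (0 : ℝ)..x, g t
  have hGw := hG.isWeakDeriv
  -- `f - G` has zero weak derivative, hence is constant; testing against `χ`, of integral one,
  -- reads off the constant.
  set c := ∫ x, (f x - G x) * χ x with hc
  have li : LocallyIntegrable (fun x => f x - G x) := h.1.sub hGw.1
  refine ⟨fun x => c + G x, ?_, ?_⟩
  · refine ⟨h.2.1, fun x y => ?_⟩
    rw [← hG.2]
    ring
  · have key : ∀ᵐ x, f x - G x = c := by
      refine ae_eq_of_integral_contDiff_smul_eq li (locallyIntegrable_const c) fun ψ hψ hψc => ?_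
      obtain ⟨η, hη, hηc, hηd⟩ := exists_deriv_eq_sub hχ hχc hχ1 hψ hψc
      have e1 := h.2.2 η hη hηc
      have e2 := hGw.2.2 η hη hηc
      have hηdc : Continuous (deriv η) := hη.continuous_deriv (by simp)
      have e3 : ∫ x, (f x - G x) * deriv η x = 0 := by
        simp only [sub_mul]
        rw [integral_sub (integrable_mul_test h.1 hηdc hηc.deriv)
          (integrable_mul_test hGw.1 hηdc hηc.deriv), e1, e2, sub_self]
      rw [hηd] at e3
      have e4 : ∀ x, (f x - G x) * (ψ x - (∫ y, ψ y) * χ x) =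
        (f x - G x) * ψ x - (∫ y, ψ y) * ((f x - G x) * χ x) := fun x => by ring
      simp only [e4] at e3
      rw [integral_sub (integrable_mul_test li hψ.continuous hψc)
        ((integrable_mul_test li hχ.continuous hχc).const_mul _),
        integral_const_mul, ← hc] at e3
      simp only [smul_eq_mul, mul_comm (ψ _)]
      rw [integral_const_mul]
      linarith
    filter_upwards [key] with x hx
    linarith

/-! ### Square-integrable functions, `H²` triples and the shifted energy -/

theorem integrable_sq {f : ℝ → ℝ} (hf : MemLp f 2) : Integrable (fun x => f x ^ 2) :=
  hf.integrable_sq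

theorem integrable_mul {f g : ℝ → ℝ} (hf : MemLp f 2) (hg : MemLp g 2) :
    Integrable (fun x => f x * g x) :=
  hf.integrable_mul hg

theorem integral_add_sq {f g : ℝ → ℝ} (hf : MemLp f 2) (hg : MemLp g 2) :
    ∫ x, (f x + g x) ^ 2 = (∫ x, f x ^ 2) + 2 * (∫ x, f x * g x) + ∫ x, g x ^ 2 := by
  have h : ∀ x, (f x + g x) ^ 2 = f x ^ 2 + 2 * (f x * g x) + g x ^ 2 := fun x => by ring
  simp only [h]
  rw [integral_add (f := fun x => f x ^ 2 + 2 * (f x * g x))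
    ((integrable_sq hf).add ((integrable_mul hf hg).const_mul 2)) (integrable_sq hg),
    integral_add (integrable_sq hf) ((integrable_mul hf hg).const_mul 2),
    integral_const_mul]

theorem integral_add_mul_sq {f g : ℝ → ℝ} (hf : MemLp f 2) (hg : MemLp g 2) (t : ℝ) :
    ∫ x, (f x + t * g x) ^ 2
      = (∫ x, f x ^ 2) + 2 * t * (∫ x, f x * g x) + t ^ 2 * ∫ x, g x ^ 2 := by
  rw [integral_add_sq hf (hg.const_mul t)]
  have h1 : ∀ x, f x * (t * g x) = t * (f x * g x) := fun x => by ring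
  have h2 : ∀ x, (t * g x) ^ 2 = t ^ 2 * g x ^ 2 := fun x => by ring
  simp only [h1, h2, integral_const_mul]
  ring

theorem integral_sq_nonneg (f : ℝ → ℝ) : 0 ≤ ∫ x, f x ^ 2 :=
  integral_nonneg fun x => sq_nonneg (f x)

/-- The Cauchy-Schwarz inequality. -/
theorem sq_integral_mul_le {f g : ℝ → ℝ} (hf : MemLp f 2) (hg : MemLp g 2) :
    (∫ x, f x * g x) ^ 2 ≤ (∫ x, f x ^ 2) * ∫ x, g x ^ 2 := by
  have h : ∀ t : ℝ, 0 ≤ (∫ x, g x ^ 2) * (t * t) + (2 * ∫ x, f x * g x) * t + ∫ x, f x ^ 2 := by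
    intro t
    have := integral_sq_nonneg (fun x => f x + t * g x)
    rw [integral_add_mul_sq hf hg] at this
    linarith
  have := discrim_le_zero h
  rw [discrim] at this
  linarith

/-- `f` is an `H²` function, in its continuously differentiable representative, with first
derivative `g` and weak second derivative `k`. -/
structure IsH2 (f g k : ℝ → ℝ) : Prop where
  prim₁ : IsPrimitive f g
  prim₂ : IsPrimitive g k
  mem₀ : MemLp f 2
  mem₁ : MemLp g 2
  mem₂ : MemLp k 2

theorem isWeakDeriv_congr {f f' g : ℝ → ℝ} (h : f =ᵐ[volume] f') :
    IsWeakDeriv f g ↔ IsWeakDeriv f' g := by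
  have aux : ∀ {f f' : ℝ → ℝ}, f =ᵐ[volume] f' → IsWeakDeriv f g → IsWeakDeriv f' g := by
    intro f f' h hw
    refine ⟨hw.1.congr h, hw.2.1, fun η hη hc => ?_⟩
    rw [← hw.2.2 η hη hc]
    exact integral_congr_ae (h.mono fun x hx => by simp only [hx])
  exact ⟨aux h, aux h.symm⟩

theorem weakDeriv_congr {f f' : ℝ → ℝ} (h : f =ᵐ[volume] f') : weakDeriv f = weakDeriv f' := by
  have : IsWeakDeriv f = IsWeakDeriv f' := funext fun g => propext (isWeakDeriv_congr h)
  unfold weakDeriv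
  rw [this]

theorem energy_congr {b p : ℝ} {f f' : ℝ → ℝ} (h : f =ᵐ[volume] f') :
    energy b p f = energy b p f' := by
  have : ∫ x, |f x| ^ (p + 1) = ∫ x, |f' x| ^ (p + 1) :=
    integral_congr_ae (h.mono fun x hx => by simp only [hx])
  rw [energy, energy, weakDeriv_congr h, this]

theorem exists_isH2_of_isWeakDeriv {f g k : ℝ → ℝ} (hfg : IsWeakDeriv f g) (hgk : IsWeakDeriv g k)
    (h0 : MemLp f 2) (h1 : MemLp g 2) (h2 : MemLp k 2) :
    ∃ f' g', IsH2 f' g' k ∧ f =ᵐ[volume] f' ∧ g =ᵐ[volume] g' := by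
  obtain ⟨g', hg, hgg⟩ := hgk.exists_isPrimitive
  obtain ⟨f', hf, hff⟩ := hfg.exists_isPrimitive
  exact ⟨f', g', ⟨hf.congr_ae hgg.symm, hg, h0.ae_eq hff.symm, h1.ae_eq hgg.symm, h2⟩,
    hff.symm, hgg.symm⟩

theorem MemH.exists_isH2 {φ : ℝ → ℝ} (h : MemH 2 φ) :
    ∃ f g k, IsH2 f g k ∧ φ =ᵐ[volume] f := by
  obtain ⟨h0, u, hu, h1, v, hv, h2⟩ := h
  obtain ⟨f, g, hfg, hf, -⟩ := exists_isH2_of_isWeakDeriv hu hv h0 h1 h2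
  exact ⟨f, g, v, hfg, hf⟩

/-- The nonlinear part `∫ |f|^(p+1)` of the energy. -/
def powInt (p : ℝ) (f : ℝ → ℝ) : ℝ := ∫ x, |f x| ^ (p + 1)

theorem powInt_nonneg (p : ℝ) (f : ℝ → ℝ) : 0 ≤ powInt p f :=
  integral_nonneg fun _ => Real.rpow_nonneg (abs_nonneg _) _

/-- The quadratic part of the energy, shifted by the bottom of the spectrum of
`∂⁴ + b ∂²`. -/
def quadForm (b : ℝ) (f g k : ℝ → ℝ) : ℝ :=
  (∫ x, k x ^ 2) - b * (∫ x, g x ^ 2) + (max b 0) ^ 2 / 4 * ∫ x, f x ^ 2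

/-- The energy, shifted so that its quadratic part is nonnegative. -/
def shiftedEnergy (b p : ℝ) (f g k : ℝ → ℝ) : ℝ :=
  1 / 2 * quadForm b f g k - 1 / (p + 1) * powInt p f

namespace IsH2

variable {f g k f' g' k' : ℝ → ℝ}

theorem memH (h : IsH2 f g k) : MemH 2 f :=
  ⟨h.mem₀, g, h.prim₁.isWeakDeriv, h.mem₁, k, h.prim₂.isWeakDeriv, h.mem₂⟩

/-- The difference depends on the mass alone, so on a mass sphere both functionals have the same
minimizers. -/
theorem energy_eq (h : IsH2 f g k) (b p : ℝ) :
    energy b p f = shiftedEnergy b p f g k - (max b 0) ^ 2 / 8 * ∫ x, f x ^ 2 := by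
  have h1 : weakDeriv f =ᵐ[volume] g :=
    (weakDeriv_spec h.prim₁.isWeakDeriv).ae_eq h.prim₁.isWeakDeriv
  have h2 : weakDeriv (weakDeriv f) =ᵐ[volume] k := by
    rw [weakDeriv_congr h1]
    exact (weakDeriv_spec h.prim₂.isWeakDeriv).ae_eq h.prim₂.isWeakDeriv
  have h3 : ∫ x, (|weakDeriv (weakDeriv f) x| ^ 2 - b * |weakDeriv f x| ^ 2)
      = ∫ x, (k x ^ 2 - b * g x ^ 2) := by
    apply integral_congr_ae
    filter_upwards [h1, h2] with x e1 e2
    rw [e1, e2, sq_abs, sq_abs]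
  rw [energy, h3, integral_sub (integrable_sq h.mem₂) ((integrable_sq h.mem₁).const_mul _),
    integral_const_mul, shiftedEnergy, quadForm, powInt]
  ring

theorem add (h : IsH2 f g k) (h' : IsH2 f' g' k') :
    IsH2 (fun x => f x + f' x) (fun x => g x + g' x) (fun x => k x + k' x) :=
  ⟨h.prim₁.add h'.prim₁, h.prim₂.add h'.prim₂, h.mem₀.add h'.mem₀, h.mem₁.add h'.mem₁,
    h.mem₂.add h'.mem₂⟩

theorem const_mul (t : ℝ) (h : IsH2 f g k) :
    IsH2 (fun x => t * f x) (fun x => t * g x) (fun x => t * k x) :=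
  ⟨h.prim₁.const_mul t, h.prim₂.const_mul t, h.mem₀.const_mul t, h.mem₁.const_mul t,
    h.mem₂.const_mul t⟩

theorem comp_add_right (h : IsH2 f g k) (c : ℝ) :
    IsH2 (fun x => f (x + c)) (fun x => g (x + c)) (fun x => k (x + c)) :=
  have hm := measurePreserving_add_right (volume : Measure ℝ) c
  ⟨h.prim₁.comp_add_right c, h.prim₂.comp_add_right c, h.mem₀.comp_measurePreserving hm,
    h.mem₁.comp_measurePreserving hm, h.mem₂.comp_measurePreserving hm⟩

theorem hasDerivAt (h : IsH2 f g k) (x : ℝ) : HasDerivAt f (g x) x :=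
  h.prim₁.hasDerivAt h.prim₂.continuous x

theorem integral_sq_deriv (h : IsH2 f g k) : ∫ x, g x ^ 2 = -∫ x, f x * k x := by
  have h1 : Integrable (fun x => g x * g x) := integrable_mul h.mem₁ h.mem₁
  have h2 := integrable_mul h.mem₀ h.mem₂
  have := (h.prim₁.mul h.prim₂).integral_eq_zero (integrable_mul h.mem₀ h.mem₁) (h1.add h2)
  rw [integral_add h1 h2] at this
  simp only [sq]
  linarith

theorem sq_integral_sq_deriv_le (h : IsH2 f g k) :
    (∫ x, g x ^ 2) ^ 2 ≤ (∫ x, f x ^ 2) * ∫ x, k x ^ 2 := by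
  rw [h.integral_sq_deriv, neg_sq]
  exact sq_integral_mul_le h.mem₀ h.mem₂

/-- `f²` has derivative `2fg` and vanishes at `-∞`. -/
theorem sq_le_integral (h : IsH2 f g k) (x : ℝ) : f x ^ 2 ≤ 2 * ∫ t, |f t| * |g t| := by
  have i1 := integrable_mul h.mem₀ h.mem₁
  have hp := h.prim₁.mul h.prim₁
  have i2 : Integrable (fun t => g t * f t + f t * g t) := by
    simp only [mul_comm (g _)]
    exact i1.add i1
  have hb := hp.tendsto_atBot (integrable_mul h.mem₀ h.mem₀) i2
  have h1 : ∀ y ≤ x, f x ^ 2 - f y * f y ≤ 2 * ∫ t, |f t| * |g t| := by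
    intro y hy
    rw [sq, hp.2 y x, intervalIntegral.integral_of_le hy, ← integral_const_mul]
    refine (le_abs_self _).trans ((abs_integral_le_integral_abs).trans ?_)
    have i3 : Integrable (fun t => 2 * (|f t| * |g t|)) := by
      simpa [abs_mul] using i1.abs.const_mul 2
    refine (setIntegral_mono_on i2.abs.integrableOn i3.integrableOn measurableSet_Ioc
      fun t _ => ?_).trans (setIntegral_le_integral i3 (ae_of_all _ fun t => by positivity))
    rw [mul_comm (g t), ← two_mul, abs_mul, abs_mul, abs_two]
  have h2 : Tendsto (fun y => f x ^ 2 - f y * f y) atBot (𝓝 (f x ^ 2 - 0)) := hb.const_sub _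
  rw [sub_zero] at h2
  exact le_of_tendsto h2 (eventually_atBot.2 ⟨x, h1⟩)

/-- A Gagliardo–Nirenberg inequality, from `f² ≤ 2I`, `I² ≤ AG` and `G² ≤ AK` in the notation of the
proof. The eighth power avoids roots. -/
theorem pow_eight_le (h : IsH2 f g k) (x : ℝ) :
    f x ^ 8 ≤ 16 * (∫ t, f t ^ 2) ^ 3 * ∫ t, k t ^ 2 := by
  have h1 := h.sq_le_integral x
  have h2 := sq_integral_mul_le (f := fun t => |f t|) (g := fun t => |g t|) h.mem₀.abs h.mem₁.abs
  simp only [sq_abs] at h2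
  have h3 := h.sq_integral_sq_deriv_le
  have hA := integral_sq_nonneg f
  have hG := integral_sq_nonneg g
  set A := ∫ t, f t ^ 2
  set G := ∫ t, g t ^ 2
  set K := ∫ t, k t ^ 2
  set I := ∫ t, |f t| * |g t|
  calc f x ^ 8 = (f x ^ 2) ^ 4 := by ring
    _ ≤ (2 * I) ^ 4 := pow_le_pow_left₀ (sq_nonneg _) h1 4
    _ = 16 * (I ^ 2) ^ 2 := by ring
    _ ≤ 16 * (A * G) ^ 2 := by
      gcongr
    _ = 16 * A ^ 2 * G ^ 2 := by ring
    _ ≤ 16 * A ^ 2 * (A * K) := by gcongr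
    _ = 16 * A ^ 3 * K := by ring

/-- Completing the square: the cross term is turned into `∫ g²` by integration by parts, and `b = b₊
- b₋` leaves only the `b₋` part. -/
theorem quadForm_eq (h : IsH2 f g k) (b : ℝ) :
    quadForm b f g k
      = (∫ x, (k x + max b 0 / 2 * f x) ^ 2) + max (-b) 0 * ∫ x, g x ^ 2 := by
  rw [quadForm, integral_add_mul_sq h.mem₂ h.mem₀]
  have e := h.integral_sq_deriv
  simp only [mul_comm (k _)]
  rw [show ∫ x, f x * k x = -∫ x, g x ^ 2 by rw [e, neg_neg]]
  have hb : b = max b 0 - max (-b) 0 := by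
    rcases le_total b 0 with hb | hb <;> simp [hb]
  nth_rewrite 1 [hb]
  ring

theorem quadForm_nonneg (h : IsH2 f g k) (b : ℝ) : 0 ≤ quadForm b f g k := by
  rw [h.quadForm_eq]
  exact add_nonneg (integral_sq_nonneg _) (mul_nonneg (le_max_right _ _) (integral_sq_nonneg g))

theorem abs_rpow_le (p M : ℝ) (hp : 1 < p) {y : ℝ} (hy : |y| ≤ M) :
    |y| ^ (p + 1) ≤ M ^ (p - 1) * y ^ 2 := by
  have : |y| ^ (p + 1) = |y| ^ (p - 1) * y ^ 2 := by
    rw [← sq_abs, ← Real.rpow_natCast, ← Real.rpow_add_of_nonneg (abs_nonneg _) (by linarith)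
      (by norm_num)]
    norm_num
    ring_nf
  rw [this]
  gcongr

theorem integrable_rpow {p M : ℝ} (hp : 1 < p) (hc : Continuous f) (hf : MemLp f 2)
    (hM : ∀ x, |f x| ≤ M) : Integrable (fun x => |f x| ^ (p + 1)) := by
  refine ((integrable_sq hf).const_mul (M ^ (p - 1))).mono'
    (hc.abs.rpow_const fun x => Or.inr (by linarith)).aestronglyMeasurable
    (ae_of_all _ fun x => ?_)
  rw [Real.norm_of_nonneg (Real.rpow_nonneg (abs_nonneg _) _)]
  exact abs_rpow_le p M hp (hM x)

/-- A crude root-free bound, enough wherever only uniform boundedness matters. -/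
theorem abs_apply_le (h : IsH2 f g k) (x : ℝ) :
    |f x| ≤ (16 * (∫ t, f t ^ 2) ^ 3 * ∫ t, k t ^ 2) + 1 := by
  have h1 := h.pow_eight_le x
  rcases le_total (|f x|) 1 with h2 | h2
  · have : 0 ≤ f x ^ 8 := by positivity
    linarith
  · have : |f x| ≤ |f x| ^ 8 := le_self_pow₀ h2 (by norm_num)
    rw [← abs_pow, abs_of_nonneg (by positivity : 0 ≤ f x ^ 8)] at this
    linarith

theorem integrable_abs_rpow (h : IsH2 f g k) {p : ℝ} (hp : 1 < p) :
    Integrable (fun x => |f x| ^ (p + 1)) :=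
  integrable_rpow hp h.prim₁.continuous h.mem₀ h.abs_apply_le

theorem powInt_le (h : IsH2 f g k) {p M : ℝ} (hp : 1 < p) (hM : ∀ x, |f x| ≤ M) :
    powInt p f ≤ M ^ (p - 1) * ∫ x, f x ^ 2 := by
  rw [powInt, ← integral_const_mul]
  exact integral_mono (h.integrable_abs_rpow hp) ((integrable_sq h.mem₀).const_mul _)
    fun x => abs_rpow_le p M hp (hM x)

theorem powInt_pos (h : IsH2 f g k) {p : ℝ} (hp : 1 < p) {x₀ : ℝ} (hx : f x₀ ≠ 0) :
    0 < powInt p f := by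
  refine integral_pos_of_integrable_nonneg_nonzero
    (h.prim₁.continuous.abs.rpow_const fun x => Or.inr (by linarith)) (h.integrable_abs_rpow hp)
    (fun x => Real.rpow_nonneg (abs_nonneg _) _) (x := x₀) ?_
  exact (Real.rpow_pos_of_pos (abs_pos.2 hx) _).ne'

theorem integral_sq_pos (h : IsH2 f g k) {x₀ : ℝ} (hx : f x₀ ≠ 0) : 0 < ∫ x, f x ^ 2 :=
  integral_pos_of_integrable_nonneg_nonzero (h.prim₁.continuous.pow 2) (integrable_sq h.mem₀)
    (fun x => sq_nonneg (f x)) (x := x₀) (pow_ne_zero 2 hx)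

end IsH2

theorem powInt_const_mul (p t : ℝ) (f : ℝ → ℝ) :
    powInt p (fun x => t * f x) = |t| ^ (p + 1) * powInt p f := by
  simp only [powInt, abs_mul, Real.mul_rpow (abs_nonneg _) (abs_nonneg _), integral_const_mul]

theorem integral_const_mul_sq (t : ℝ) (f : ℝ → ℝ) :
    ∫ x, (t * f x) ^ 2 = t ^ 2 * ∫ x, f x ^ 2 := by
  simp only [mul_pow, integral_const_mul]

theorem quadForm_const_mul (b t : ℝ) (f g k : ℝ → ℝ) :
    quadForm b (fun x => t * f x) (fun x => t * g x) (fun x => t * k x)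
      = t ^ 2 * quadForm b f g k := by
  simp only [quadForm, integral_const_mul_sq]
  ring

theorem shiftedEnergy_comp_add_right (b p c : ℝ) (f g k : ℝ → ℝ) :
    shiftedEnergy b p (fun x => f (x + c)) (fun x => g (x + c)) (fun x => k (x + c))
      = shiftedEnergy b p f g k := by
  rw [shiftedEnergy, shiftedEnergy, quadForm, quadForm, powInt, powInt,
    integral_add_right_eq_self (fun x => |f x| ^ (p + 1)) c,
    integral_add_right_eq_self (fun x => f x ^ 2) c,
    integral_add_right_eq_self (fun x => g x ^ 2) c,
    integral_add_right_eq_self (fun x => k x ^ 2) c]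

/-! ### Weak compactness in `L²` and splitting of the nonlinear term -/

/-- Bounded sequences in `L²(ℝ)` have weakly convergent subsequences. -/
theorem exists_weak_limit {u : ℕ → ℝ → ℝ} (hu : ∀ n, MemLp (u n) 2) {M : ℝ}
    (hM : ∀ n, ∫ x, u n x ^ 2 ≤ M) :
    ∃ v : ℝ → ℝ, MemLp v 2 ∧ ∃ σ : ℕ → ℕ, StrictMono σ ∧ ∀ w : ℝ → ℝ, MemLp w 2 →
      Tendsto (fun n => ∫ x, u (σ n) x * w x) atTop (𝓝 (∫ x, v x * w x)) := by
  have : Fact ((2 : ENNReal) ≠ ⊤) := ⟨by simp⟩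
  let H := Lp ℝ 2 (volume : Measure ℝ)
  have inner_eq : ∀ {a c : ℝ → ℝ} (ha : MemLp a 2) (hc : MemLp c 2),
      inner ℝ (ha.toLp a) (hc.toLp c) = ∫ x, a x * c x := by
    intro a c ha hc
    rw [L2.inner_def]
    apply integral_congr_ae
    filter_upwards [ha.coeFn_toLp, hc.coeFn_toLp] with x h1 h2
    rw [h1, h2]
    simp [mul_comm]
  let U : ℕ → H := fun n => (hu n).toLp (u n)
  -- Riesz representation places the sequence in a ball of the dual, which is weak-* sequentially
  -- compact.
  let φ : ℕ → WeakDual ℝ H := fun n =>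
    WeakDual.toStrongDual.symm (InnerProductSpace.toDual ℝ H (U n))
  have hφ : ∀ n, φ n ∈ WeakDual.toStrongDual ⁻¹' Metric.closedBall (0 : StrongDual ℝ H) (√M) := by
    intro n
    simp only [mem_preimage, mem_closedBall_zero_iff, φ, LinearEquiv.apply_symm_apply,
      LinearIsometryEquiv.norm_map]
    apply Real.le_sqrt_of_sq_le
    rw [← real_inner_self_eq_norm_sq, inner_eq]
    simpa [sq] using hM n
  obtain ⟨ℓ, -, σ, hσ, hℓ⟩ := WeakDual.isSeqCompact_closedBall ℝ H 0 (√M) hφ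
  let V : H := (InnerProductSpace.toDual ℝ H).symm (WeakDual.toStrongDual ℓ)
  refine ⟨V, Lp.memLp V, σ, hσ, fun w hw => ?_⟩
  have h1 : Tendsto (fun n => φ (σ n) (hw.toLp w)) atTop (𝓝 (ℓ (hw.toLp w))) :=
    ((WeakDual.eval_continuous (hw.toLp w)).tendsto ℓ).comp hℓ
  have h2 : ℓ (hw.toLp w) = ∫ x, V x * w x := by
    rw [← inner_eq (Lp.memLp V) hw, Lp.toLp_coeFn, InnerProductSpace.toDual_symm_apply]
    rfl
  rw [← h2]
  refine h1.congr fun n => ?_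
  rw [← inner_eq (hu _) hw]
  rfl

/-- The mean value inequality for `|·|^q` on `[-2|a|, 2|a|]` handles `|a + c|^q - |a|^q`; the term
`|c|^q` is absorbed using `|c| ≤ |a| ≤ M`. The bilinear bound lets weak convergence kill the
interaction. -/
theorem abs_abs_rpow_sub_le {q M : ℝ} (hq : 2 < q) {a c : ℝ} (hca : |c| ≤ |a|) (ha : |a| ≤ M) :
    |(|a + c| ^ q - |a| ^ q - |c| ^ q)| ≤ (2 * q * (2 * M) ^ (q - 2) + M ^ (q - 2)) * (|a| * |c|) := by
  have hM : 0 ≤ M := (abs_nonneg a).trans ha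
  have pw : ∀ y : ℝ, 0 ≤ y → y ^ (q - 1) = y ^ (q - 2) * y := fun y hy => by
    rw [← Real.rpow_add_one' hy (by linarith)]
    ring_nf
  have h1 : |(|a + c| ^ q - |a| ^ q)| ≤ (q * (2 * |a|) ^ (q - 1)) * |a + c - a| := by
    have hb : ∀ x ∈ Icc (-(2 * |a|)) (2 * |a|),
        ‖q * |x| ^ (q - 2) * x‖ ≤ q * (2 * |a|) ^ (q - 1) := by
      intro x hx
      have hx' : |x| ≤ 2 * |a| := abs_le.2 hx
      rw [Real.norm_eq_abs, abs_mul, abs_mul, abs_of_pos (by linarith : 0 < q),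
        abs_of_nonneg (Real.rpow_nonneg (abs_nonneg x) _), mul_assoc, ← pw _ (abs_nonneg x)]
      gcongr
      linarith
    refine (convex_Icc _ _).norm_image_sub_le_of_norm_hasDerivWithin_le
      (fun x _ => (hasDerivAt_abs_rpow x (by linarith)).hasDerivWithinAt) hb ?_ ?_
    · exact abs_le.1 (by linarith [abs_nonneg a])
    · exact abs_le.1 ((abs_add_le a c).trans (by linarith))
  have h2 : |c| ^ q ≤ M ^ (q - 2) * (|a| * |c|) := by
    have : |c| ^ q = |c| ^ (q - 2) * (|c| * |c|) := by
      rw [← mul_assoc, ← pw _ (abs_nonneg c), ← Real.rpow_add_one' (abs_nonneg c) (by linarith)]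
      ring_nf
    rw [this]
    gcongr
    exact hca.trans ha
  have h3 : (q * (2 * |a|) ^ (q - 1)) * |a + c - a| ≤ 2 * q * (2 * M) ^ (q - 2) * (|a| * |c|) := by
    rw [pw _ (by positivity), add_sub_cancel_left]
    have : (2 * |a|) ^ (q - 2) ≤ (2 * M) ^ (q - 2) := by gcongr
    calc q * ((2 * |a|) ^ (q - 2) * (2 * |a|)) * |c|
        = 2 * q * (2 * |a|) ^ (q - 2) * (|a| * |c|) := by ring
      _ ≤ _ := by gcongr
  have h4 := abs_sub (|a + c| ^ q - |a| ^ q) (|c| ^ q)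
  rw [abs_of_nonneg (Real.rpow_nonneg (abs_nonneg c) q)] at h4
  linarith

theorem exists_abs_rpow_add_sub_le {q : ℝ} (hq : 2 < q) (M : ℝ) :
    ∃ C, ∀ a c : ℝ, |a| ≤ M → |c| ≤ M →
      |(|a + c| ^ q - |a| ^ q - |c| ^ q)| ≤ C * (|a| * |c|) := by
  refine ⟨2 * q * (2 * M) ^ (q - 2) + M ^ (q - 2), fun a c ha hc => ?_⟩
  rcases le_total |c| |a| with h | h
  · exact abs_abs_rpow_sub_le hq h ha
  · have := abs_abs_rpow_sub_le hq h hc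
    rwa [add_comm c, sub_right_comm, mul_comm |c|] at this

/-- An `L²`-bounded sequence converging pointwise to zero is weakly null, in absolute value. -/
theorem tendsto_integral_abs_mul_abs {a : ℕ → ℝ → ℝ} {f : ℝ → ℝ} (ha : ∀ n, MemLp (a n) 2)
    (hf : MemLp f 2) {B : ℝ} (hB : ∀ n, ∫ x, a n x ^ 2 ≤ B)
    (h0 : ∀ x, Tendsto (fun n => a n x) atTop (𝓝 0)) :
    Tendsto (fun n => ∫ x, |a n x| * |f x|) atTop (𝓝 0) := by
  have hB0 : 0 ≤ B := (integral_sq_nonneg _).trans (hB 0)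
  have im : ∀ n, Integrable (fun x => |a n x| * |f x|) := fun n => by
    simpa [abs_mul] using (integrable_mul (ha n) hf).abs
  -- No `n`-independent majorant of `|a n| |f|` is at hand. After subtracting `ε (a n)²`, the
  -- positive part is dominated by `f²/(4ε)`, while the subtracted part costs at most `εB`.
  have key : ∀ ε : ℝ, 0 < ε →
      Tendsto (fun n => ∫ x, max (|a n x| * |f x| - ε * a n x ^ 2) 0) atTop (𝓝 0) := by
    intro ε hε
    have := tendsto_integral_of_dominated_convergence (μ := volume)
      (F := fun n x => max (|a n x| * |f x| - ε * a n x ^ 2) 0) (f := fun _ => 0)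
      (fun x => 1 / (4 * ε) * f x ^ 2)
      (fun n => (((im n).sub ((integrable_sq (ha n)).const_mul ε)).pos_part).aestronglyMeasurable)
      ((integrable_sq hf).const_mul _) ?_ ?_
    · simpa using this
    · intro n
      filter_upwards with x
      rw [Real.norm_of_nonneg (le_max_right _ _)]
      refine max_le ?_ (by positivity)
      rw [← sq_abs (a n x), ← sq_abs (f x), one_div, ← div_eq_inv_mul, le_div_iff₀ (by positivity)]
      nlinarith [sq_nonneg (2 * ε * |a n x| - |f x|)]
    · filter_upwards with x
      have h1 : Tendsto (fun n => max (|a n x| * |f x| - ε * a n x ^ 2) 0) atTop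
          (𝓝 (max (|0| * |f x| - ε * 0 ^ 2) 0)) :=
        (((h0 x).abs.mul_const _).sub (((h0 x).pow 2).const_mul ε)).max tendsto_const_nhds
      simpa using h1
  rw [Metric.tendsto_atTop]
  intro δ hδ
  have hε : 0 < δ / (2 * (B + 1)) := by positivity
  obtain ⟨n₀, hn₀⟩ := (Metric.tendsto_atTop.1 (key _ hε)) (δ / 2) (by positivity)
  refine ⟨n₀, fun n hn => ?_⟩
  have h1 := hn₀ n hn
  have nn : 0 ≤ ∫ x, |a n x| * |f x| := integral_nonneg fun x => by positivity
  rw [Real.dist_eq, sub_zero] at h1 ⊢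
  rw [abs_of_nonneg nn]
  set ε := δ / (2 * (B + 1))
  have i1 : Integrable fun x => max (|a n x| * |f x| - ε * a n x ^ 2) 0 :=
    ((im n).sub ((integrable_sq (ha n)).const_mul ε)).pos_part
  have i2 := (integrable_sq (ha n)).const_mul ε
  have h2 : ∫ x, |a n x| * |f x| ≤
      ∫ x, (max (|a n x| * |f x| - ε * a n x ^ 2) 0 + ε * a n x ^ 2) :=
    integral_mono (im n) (i1.add i2) fun x => by
      have := le_max_left (|a n x| * |f x| - ε * a n x ^ 2) 0
      simp only
      linarith
  rw [integral_add i1 i2, integral_const_mul] at h2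
  have h3 : ε * ∫ x, a n x ^ 2 ≤ δ / 2 := by
    calc ε * ∫ x, a n x ^ 2 ≤ ε * (B + 1) := by gcongr; linarith [hB n]
      _ = δ / 2 := by simp only [ε]; field_simp
  have := (abs_lt.1 h1).2
  linarith

/-- The Brezis-Lieb splitting of `∫ |f|^(p+1)`. -/
theorem tendsto_powInt_split {p M B : ℝ} (hp : 1 < p) {a u v : ℕ → ℝ → ℝ} {f g k : ℝ → ℝ}
    (ha : ∀ n, IsH2 (a n) (u n) (v n)) (hf : IsH2 f g k) (haM : ∀ n x, |a n x| ≤ M)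
    (hfM : ∀ x, |f x| ≤ M) (hB : ∀ n, ∫ x, a n x ^ 2 ≤ B)
    (h0 : ∀ x, Tendsto (fun n => a n x) atTop (𝓝 0)) :
    Tendsto (fun n => powInt p (fun x => a n x + f x) - powInt p (a n) - powInt p f) atTop
      (𝓝 0) := by
  obtain ⟨C, hC⟩ := exists_abs_rpow_add_sub_le (q := p + 1) (by linarith) M
  have h1 := (tendsto_integral_abs_mul_abs (fun n => (ha n).mem₀) hf.mem₀ hB h0).const_mul C
  rw [mul_zero] at h1
  refine squeeze_zero_norm (fun n => ?_) h1
  have i1 := ((ha n).add hf).integrable_abs_rpow hp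
  have i2 := (ha n).integrable_abs_rpow hp
  have i3 := hf.integrable_abs_rpow hp
  rw [powInt, powInt, powInt, ← integral_sub i1 i2,
    ← integral_sub (f := fun x => |a n x + f x| ^ (p + 1) - |a n x| ^ (p + 1)) (i1.sub i2) i3,
    ← integral_const_mul, Real.norm_eq_abs]
  refine abs_integral_le_integral_abs.trans ?_
  refine integral_mono ((i1.sub i2).sub i3).abs ?_ fun x => hC _ _ (haM n x) (hfM x)
  refine Integrable.const_mul ?_ C
  simpa [abs_mul] using (integrable_mul (ha n).mem₀ hf.mem₀).abs

/-! ### Scaling and coercivity -/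

theorem shiftedEnergy_sqrt_mul {b p θ : ℝ} (hθ : 0 ≤ θ) (f g k : ℝ → ℝ) :
    shiftedEnergy b p (fun x => √θ * f x) (fun x => √θ * g x) (fun x => √θ * k x)
      = θ * (1 / 2 * quadForm b f g k) - θ ^ ((p + 1) / 2) * (1 / (p + 1) * powInt p f) := by
  rw [shiftedEnergy, quadForm_const_mul, powInt_const_mul, Real.sq_sqrt hθ,
    abs_of_nonneg (Real.sqrt_nonneg _), Real.sqrt_eq_rpow, ← Real.rpow_mul hθ]
  ring_nf

/-- After division by `K` the two subtracted terms carry negative powers of `K`. -/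
theorem exists_forall_sub_pos {a C s : ℝ} (hs : s < 1) :
    ∃ K₀ : ℝ, 0 ≤ K₀ ∧ ∀ K, K₀ < K → 0 < 1 / 2 * K - a * √K - C * K ^ s := by
  have h1 : Tendsto (fun K : ℝ => a * K ^ (-(1 / 2) : ℝ) + C * K ^ (-(1 - s))) atTop
      (𝓝 (a * 0 + C * 0)) :=
    ((tendsto_rpow_neg_atTop (by norm_num)).const_mul a).add
      ((tendsto_rpow_neg_atTop (by linarith)).const_mul C)
  rw [mul_zero, mul_zero, add_zero] at h1
  obtain ⟨K₀, hK⟩ := eventually_atTop.1 (h1.eventually_lt_const (by norm_num : (0 : ℝ) < 1 / 2))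
  refine ⟨max K₀ 0, le_max_right _ _, fun K hlt => ?_⟩
  have hpos : 0 < K := (le_max_right _ _).trans_lt hlt
  have h2 := mul_lt_mul_of_pos_right (hK K ((le_max_left _ _).trans hlt.le)) hpos
  rw [add_mul, mul_assoc, mul_assoc, ← Real.rpow_add_one hpos.ne', ← Real.rpow_add_one hpos.ne',
    neg_sub, sub_add_cancel, show (-(1 / 2) + 1 : ℝ) = 1 / 2 by norm_num,
    ← Real.sqrt_eq_rpow] at h2
  linarith

/-- Coercivity of the energy on the mass sphere in the subcritical regime. -/
theorem exists_coercivity {p : ℝ} (b lam : ℝ) (hp1 : 1 < p) (hp9 : p < 9) :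
    ∃ K₀ m₀ : ℝ, ∀ f g k, IsH2 f g k → ∫ x, f x ^ 2 = lam →
      m₀ ≤ shiftedEnergy b p f g k ∧ (shiftedEnergy b p f g k ≤ 0 → ∫ x, k x ^ 2 ≤ K₀) := by
  -- The sup norm is bounded by a multiple of `K^(1/8)` and enters the power integral to the power
  -- `p - 1`; `s < 1` is the condition `p < 9`.
  set s := (p - 1) / 8
  set a := 1 / 2 * (|b| * √lam)
  set C := 1 / (p + 1) * ((16 * lam ^ 3) ^ s * lam)
  obtain ⟨K₀, hK₀, hK⟩ := exists_forall_sub_pos (a := a) (C := C) (s := s)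
    (by simp only [s]; linarith)
  have lower : ∀ f g k, IsH2 f g k → ∫ x, f x ^ 2 = lam →
      1 / 2 * (∫ x, k x ^ 2) - a * √(∫ x, k x ^ 2) - C * (∫ x, k x ^ 2) ^ s
        ≤ shiftedEnergy b p f g k := by
    intro f g k h hm
    have hA := integral_sq_nonneg f
    have hG := integral_sq_nonneg g
    have hk := integral_sq_nonneg k
    have h1 := h.sq_integral_sq_deriv_le
    have h2 := h.pow_eight_le
    rw [shiftedEnergy, quadForm]
    rw [hm] at h1 h2 hA ⊢
    set G := ∫ x, g x ^ 2
    set K := ∫ x, k x ^ 2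
    have h3 : b * G ≤ |b| * (√lam * √K) := by
      have : G ≤ √lam * √K := by
        rw [← Real.sqrt_mul hA]
        exact Real.le_sqrt_of_sq_le h1
      calc b * G ≤ |b| * G := by gcongr; exact le_abs_self b
        _ ≤ _ := by gcongr
    have h4 : powInt p f ≤ (16 * lam ^ 3) ^ s * K ^ s * lam := by
      have hM : ∀ x, |f x| ≤ (16 * lam ^ 3 * K) ^ (1 / 8 : ℝ) := fun x => by
        rw [one_div, Real.le_rpow_inv_iff_of_pos (abs_nonneg _) (by positivity) (by norm_num)]
        have := h2 x
        rw [← Even.pow_abs (by decide : Even 8)] at this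
        exact_mod_cast this
      have := h.powInt_le hp1 hM
      rw [hm, ← Real.rpow_mul (by positivity)] at this
      rw [← Real.mul_rpow (by positivity) hk]
      convert this using 3
      simp only [s]
      ring
    have h5 : 1 / (p + 1) * powInt p f ≤ C * K ^ s := by
      calc 1 / (p + 1) * powInt p f ≤ 1 / (p + 1) * ((16 * lam ^ 3) ^ s * K ^ s * lam) := by
            gcongr
        _ = C * K ^ s := by simp only [C]; ring
    have h6 : 0 ≤ (max b 0) ^ 2 / 4 * lam := by positivity
    simp only [a]
    nlinarith
  -- Beyond `K₀` the lower bound is positive; up to `K₀` the term `K/2` is dropped and the others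
  -- are monotone in `K`.
  refine ⟨K₀, min 0 (-(a * √K₀) - C * K₀ ^ s), fun f g k h hm => ?_⟩
  have hl := lower f g k h hm
  have hk := integral_sq_nonneg k
  have hlam : 0 ≤ lam := hm ▸ integral_sq_nonneg f
  set K := ∫ x, k x ^ 2
  constructor
  · rcases le_or_gt K K₀ with hle | hlt
    · refine (min_le_right _ _).trans (le_trans ?_ hl)
      have e1 : a * √K ≤ a * √K₀ := by gcongr
      have e2 : C * K ^ s ≤ C * K₀ ^ s := by
        have : 0 ≤ C := by simp only [C]; positivity
        have : 0 ≤ s := by simp only [s]; linarith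
        gcongr
      linarith
    · exact (min_le_left _ _).trans ((hK K hlt).le.trans hl)
  · intro hJ
    by_contra hlt
    linarith [hK K (not_le.1 hlt)]

/-! ### Energy bounds by scaling and weak compactness in `H²` -/

namespace IsH2

variable {f g k : ℝ → ℝ}

/-- Rescaling to mass `lam` bounds the shifted energy from below. -/
theorem le_scaled_shiftedEnergy {b p lam m : ℝ} (h : IsH2 f g k) (hlam : 0 < lam)
    (hm : ∀ f g k, IsH2 f g k → ∫ x, f x ^ 2 = lam → m ≤ shiftedEnergy b p f g k)
    (hβ : 0 < ∫ x, f x ^ 2) :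
    m ≤ (lam / ∫ x, f x ^ 2) * (1 / 2 * quadForm b f g k)
      - (lam / ∫ x, f x ^ 2) ^ ((p + 1) / 2) * (1 / (p + 1) * powInt p f) := by
  have hθ : 0 ≤ lam / ∫ x, f x ^ 2 := by positivity
  rw [← shiftedEnergy_sqrt_mul hθ]
  refine hm _ _ _ (h.const_mul _) ?_
  rw [integral_const_mul_sq, Real.sq_sqrt hθ]
  field_simp

/-- With `θ = lam/β ≥ 1`, rescaling multiplies the quadratic part by `θ` but the power part by
`θ^((p+1)/2) ≥ θ`, so `m ≤ θ J`. At zero mass the power part vanishes. -/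
theorem mul_le_shiftedEnergy {b p lam m : ℝ} (h : IsH2 f g k) (hp : 1 < p) (hlam : 0 < lam)
    (hm : ∀ f g k, IsH2 f g k → ∫ x, f x ^ 2 = lam → m ≤ shiftedEnergy b p f g k)
    (hβ : ∫ x, f x ^ 2 ≤ lam) :
    (∫ x, f x ^ 2) / lam * m ≤ shiftedEnergy b p f g k := by
  rcases (integral_sq_nonneg f).eq_or_lt with h0 | h0
  · have h1 := h.powInt_le hp h.abs_apply_le
    have h2 := powInt_nonneg p f
    have h3 := h.quadForm_nonneg b
    rw [← h0, mul_zero] at h1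
    rw [← h0, zero_div, zero_mul, shiftedEnergy, le_antisymm h1 h2]
    linarith
  · have h1 := h.le_scaled_shiftedEnergy hlam hm h0
    set β := ∫ x, f x ^ 2
    have hθ : 1 ≤ lam / β := (one_le_div h0).2 hβ
    have h2 : lam / β ≤ (lam / β) ^ ((p + 1) / 2) := Real.self_le_rpow_of_one_le hθ (by linarith)
    have h3 : 0 ≤ 1 / (p + 1) * powInt p f :=
      mul_nonneg (by positivity) (powInt_nonneg p f)
    have h4 : m ≤ lam / β * shiftedEnergy b p f g k := by
      rw [shiftedEnergy, mul_sub]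
      have := mul_le_mul_of_nonneg_right h2 h3
      linarith
    calc β / lam * m ≤ β / lam * (lam / β * shiftedEnergy b p f g k) := by gcongr
      _ = shiftedEnergy b p f g k := by field_simp

/-- Strictness comes from `θ > 1` and a positive power integral; it rules out a weak limit that
captures only part of the mass. -/
theorem mul_lt_shiftedEnergy {b p lam m : ℝ} (h : IsH2 f g k) (hp : 1 < p) (hlam : 0 < lam)
    (hm : ∀ f g k, IsH2 f g k → ∫ x, f x ^ 2 = lam → m ≤ shiftedEnergy b p f g k)
    (hβ : ∫ x, f x ^ 2 < lam) {x₀ : ℝ} (hx : f x₀ ≠ 0) :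
    (∫ x, f x ^ 2) / lam * m < shiftedEnergy b p f g k := by
  have h0 := h.integral_sq_pos hx
  have h1 := h.le_scaled_shiftedEnergy hlam hm h0
  have hN := h.powInt_pos hp hx
  set β := ∫ x, f x ^ 2
  have hθ : 1 < lam / β := (one_lt_div h0).2 hβ
  have h2 : lam / β < (lam / β) ^ ((p + 1) / 2) := Real.self_lt_rpow_of_one_lt hθ (by linarith)
  have h3 : 0 < 1 / (p + 1) * powInt p f := mul_pos (by positivity) hN
  have h4 : m < lam / β * shiftedEnergy b p f g k := by
    rw [shiftedEnergy, mul_sub]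
    have := mul_lt_mul_of_pos_right h2 h3
    linarith
  calc β / lam * m < β / lam * (lam / β * shiftedEnergy b p f g k) := by gcongr
    _ = shiftedEnergy b p f g k := by field_simp

/-- Point evaluation as a sum of `L²` pairings. -/
theorem exists_eval (x : ℝ) : ∃ w₁ w₂ : ℝ → ℝ, MemLp w₁ 2 ∧ MemLp w₂ 2 ∧
    ∀ f g k : ℝ → ℝ, IsH2 f g k → f x = (∫ y, f y * w₁ y) + ∫ y, g y * w₂ y := by
  have m1 : MemLp ((Ioc (x - 1) x).indicator fun _ : ℝ => (1 : ℝ)) 2 := by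
    rw [memLp_indicator_iff_restrict measurableSet_Ioc]
    exact memLp_const 1
  have m2 : MemLp ((Ioc (x - 1) x).indicator fun y : ℝ => 1 * (y - x + 1)) 2 := by
    rw [memLp_indicator_iff_restrict measurableSet_Ioc]
    refine MemLp.of_bound (by fun_prop) 1 ?_
    refine (ae_restrict_iff' measurableSet_Ioc).2 (ae_of_all _ fun y hy => ?_)
    rw [Real.norm_eq_abs, abs_le]
    exact ⟨by linarith [hy.1], by linarith [hy.2]⟩
  refine ⟨_, _, m1, m2, fun f g k h => ?_⟩
  -- The ramp vanishes at `x - 1` and equals `1` at `x`, so the increment of `f` times the ramp over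
  -- this interval is `f x`.
  have hl : IsPrimitive (fun y : ℝ => y - x + 1) (fun _ => 1) :=
    IsPrimitive.of_hasDerivAt continuous_const fun y =>
      ((hasDerivAt_id y).sub_const x).add_const 1
  have h1 := (h.prim₁.mul hl).2 (x - 1) x
  rw [intervalIntegral.integral_of_le (by linarith), ← integral_indicator measurableSet_Ioc] at h1
  rw [← integral_add (integrable_mul h.mem₀ m1) (integrable_mul h.mem₁ m2)]
  have h2 : f x = ∫ y, (Ioc (x - 1) x).indicator
      (fun t => g t * (t - x + 1) + f t * 1) y := by
    rw [← h1]
    ring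
  rw [h2]
  congr 1
  ext y
  by_cases hy : y ∈ Ioc (x - 1) x <;> simp [hy]
  ring

/-- Bounded sequences in `H²` have subsequences converging weakly and pointwise. -/
theorem exists_weak_limit {f g k : ℕ → ℝ → ℝ} (h : ∀ n, IsH2 (f n) (g n) (k n)) {A K : ℝ}
    (hA : ∀ n, ∫ x, f n x ^ 2 ≤ A) (hK : ∀ n, ∫ x, k n x ^ 2 ≤ K) :
    ∃ σ : ℕ → ℕ, StrictMono σ ∧ ∃ f' g' k', IsH2 f' g' k' ∧
      (∀ w : ℝ → ℝ, MemLp w 2 →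
        Tendsto (fun n => ∫ x, f (σ n) x * w x) atTop (𝓝 (∫ x, f' x * w x))) ∧
      (∀ w : ℝ → ℝ, MemLp w 2 →
        Tendsto (fun n => ∫ x, g (σ n) x * w x) atTop (𝓝 (∫ x, g' x * w x))) ∧
      (∀ w : ℝ → ℝ, MemLp w 2 →
        Tendsto (fun n => ∫ x, k (σ n) x * w x) atTop (𝓝 (∫ x, k' x * w x))) ∧
      ∀ x, Tendsto (fun n => f (σ n) x) atTop (𝓝 (f' x)) := by
  -- First derivatives are bounded by interpolation between `f` and `k`.
  have hG : ∀ n, ∫ x, g n x ^ 2 ≤ √(A * K) := fun n => by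
    have := (h n).sq_integral_sq_deriv_le
    refine Real.le_sqrt_of_sq_le (this.trans ?_)
    have := integral_sq_nonneg (f n)
    have := integral_sq_nonneg (k n)
    gcongr
    · exact ‹0 ≤ ∫ x, f n x ^ 2›.trans (hA n)
    · exact hA n
    · exact hK n
  obtain ⟨f₀, mf, σ₀, hσ₀, hf⟩ := Kawahara.exists_weak_limit (fun n => (h n).mem₀) hA
  obtain ⟨g₀, mg, σ₁, hσ₁, hg⟩ := Kawahara.exists_weak_limit (fun n => (h (σ₀ n)).mem₁)
    (fun n => hG (σ₀ n))
  obtain ⟨k₀, mk, σ₂, hσ₂, hk⟩ := Kawahara.exists_weak_limit (fun n => (h (σ₀ (σ₁ n))).mem₂)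
    (fun n => hK (σ₀ (σ₁ n)))
  have hf' := fun w hw => (hf w hw).comp (hσ₁.comp hσ₂).tendsto_atTop
  have hg' := fun w hw => (hg w hw).comp hσ₂.tendsto_atTop
  have wk : ∀ {u v : ℕ → ℝ → ℝ} {u₀ v₀ : ℝ → ℝ}, (∀ n, IsWeakDeriv (u n) (v n)) →
      MemLp u₀ 2 → MemLp v₀ 2 →
      (∀ w : ℝ → ℝ, MemLp w 2 →
        Tendsto (fun n => ∫ x, u n x * w x) atTop (𝓝 (∫ x, u₀ x * w x))) →
      (∀ w : ℝ → ℝ, MemLp w 2 →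
        Tendsto (fun n => ∫ x, v n x * w x) atTop (𝓝 (∫ x, v₀ x * w x))) →
      IsWeakDeriv u₀ v₀ := by
    intro u v u₀ v₀ huv hu₀ hv₀ hu hv
    refine ⟨hu₀.locallyIntegrable (by norm_num), hv₀.locallyIntegrable (by norm_num),
      fun η hη hc => ?_⟩
    have h1 := hu (deriv η)
      ((hη.continuous_deriv (by simp)).memLp_of_hasCompactSupport hc.deriv)
    have h2 := (hv η (hη.continuous.memLp_of_hasCompactSupport hc)).neg
    refine tendsto_nhds_unique h1 (h2.congr fun n => ?_)
    rw [(huv n).2.2 η hη hc]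
  obtain ⟨f', g', h', hff, hgg⟩ := exists_isH2_of_isWeakDeriv
    (wk (fun n => (h (σ₀ (σ₁ (σ₂ n)))).prim₁.isWeakDeriv) mf mg hf' hg')
    (wk (fun n => (h (σ₀ (σ₁ (σ₂ n)))).prim₂.isWeakDeriv) mg mk hg' hk) mf mg mk
  have cf : ∀ w : ℝ → ℝ, ∫ x, f₀ x * w x = ∫ x, f' x * w x := fun w =>
    integral_congr_ae (hff.mono fun x hx => by simp only [hx])
  have cg : ∀ w : ℝ → ℝ, ∫ x, g₀ x * w x = ∫ x, g' x * w x := fun w =>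
    integral_congr_ae (hgg.mono fun x hx => by simp only [hx])
  have tf : ∀ w : ℝ → ℝ, MemLp w 2 →
      Tendsto (fun n => ∫ x, f (σ₀ (σ₁ (σ₂ n))) x * w x) atTop (𝓝 (∫ x, f' x * w x)) :=
    fun w hw => cf w ▸ hf' w hw
  have tg : ∀ w : ℝ → ℝ, MemLp w 2 →
      Tendsto (fun n => ∫ x, g (σ₀ (σ₁ (σ₂ n))) x * w x) atTop (𝓝 (∫ x, g' x * w x)) :=
    fun w hw => cg w ▸ hg' w hw
  refine ⟨fun n => σ₀ (σ₁ (σ₂ n)), hσ₀.comp (hσ₁.comp hσ₂), f', g', k₀, h', tf, tg, hk,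
    fun x => ?_⟩
  obtain ⟨w₁, w₂, m1, m2, hw⟩ := exists_eval x
  rw [hw _ _ _ h']
  exact ((tf w₁ m1).add (tg w₂ m2)).congr fun n => (hw _ _ _ (h _)).symm

end IsH2

/-! ### Existence of a minimizer -/

theorem tendsto_sq_split {u : ℕ → ℝ → ℝ} {v : ℝ → ℝ} (hu : ∀ n, MemLp (u n) 2) (hv : MemLp v 2)
    (hw : Tendsto (fun n => ∫ x, u n x * v x) atTop (𝓝 (∫ x, v x * v x))) :
    Tendsto (fun n => (∫ x, u n x ^ 2) - (∫ x, (u n x + -1 * v x) ^ 2) - ∫ x, v x ^ 2) atTop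
      (𝓝 0) := by
  have h := (hw.sub_const (∫ x, v x * v x)).const_mul 2
  rw [sub_self, mul_zero] at h
  refine h.congr fun n => ?_
  rw [integral_add_mul_sq (hu n) hv]
  simp only [sq]
  ring

theorem exists_minimizing_sequence {b p lam : ℝ} (hp1 : 1 < p) (hp9 : p < 9) (hlam : 0 < lam)
    (hneg : ∃ f g k, IsH2 f g k ∧ ∫ x, f x ^ 2 = lam ∧ shiftedEnergy b p f g k < 0) :
    ∃ m < 0, (∀ f g k, IsH2 f g k → ∫ x, f x ^ 2 = lam → m ≤ shiftedEnergy b p f g k) ∧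
      ∃ δ > 0, ∃ K : ℝ, ∃ f g k : ℕ → ℝ → ℝ, (∀ n, IsH2 (f n) (g n) (k n)) ∧
        (∀ n, ∫ x, f n x ^ 2 = lam) ∧ (∀ n, ∫ x, k n x ^ 2 ≤ K) ∧ (∀ n, δ ≤ |f n 0|) ∧
        Tendsto (fun n => shiftedEnergy b p (f n) (g n) (k n)) atTop (𝓝 m) := by
  obtain ⟨K, m₀, hco⟩ := exists_coercivity b lam hp1 hp9
  set S : Set ℝ := {J | ∃ f g k, IsH2 f g k ∧ ∫ x, f x ^ 2 = lam ∧ shiftedEnergy b p f g k = J}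
  have hbd : BddBelow S := ⟨m₀, by rintro _ ⟨f, g, k, h, hm, rfl⟩; exact (hco f g k h hm).1⟩
  set m := sInf S
  have hmle : ∀ f g k, IsH2 f g k → ∫ x, f x ^ 2 = lam → m ≤ shiftedEnergy b p f g k :=
    fun f g k h hm => csInf_le hbd ⟨f, g, k, h, hm, rfl⟩
  obtain ⟨f₀, g₀, k₀, h₀, hm₀, hJ₀⟩ := hneg
  have hne : S.Nonempty := ⟨_, f₀, g₀, k₀, h₀, hm₀, rfl⟩
  have hm : m < 0 := (hmle _ _ _ h₀ hm₀).trans_lt hJ₀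
  -- Chosen so that `|f| < δ` everywhere would bound the power term by `-m/4`, forcing energy at
  -- least `m/4 > m/2`.
  set δ := ((p + 1) * (-m / 4) / lam) ^ (p - 1)⁻¹
  have hδ : 0 < δ := Real.rpow_pos_of_pos (by have := neg_pos.2 hm; positivity) _
  have step : ∀ n : ℕ, ∃ f g k, IsH2 f g k ∧ ∫ x, f x ^ 2 = lam ∧ ∫ x, k x ^ 2 ≤ K ∧
      δ ≤ |f 0| ∧ shiftedEnergy b p f g k < m + 1 / (n + 1) := by
    intro n
    obtain ⟨_, ⟨f, g, k, h, hf, rfl⟩, hlt⟩ :=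
      exists_lt_of_csInf_lt hne (show m < min (m / 2) (m + 1 / (n + 1)) from
        lt_min (by linarith) (lt_add_of_pos_right _ (by positivity)))
    obtain ⟨h1, h2⟩ := lt_min_iff.1 hlt
    have hx : ∃ x, δ ≤ |f x| := by
      by_contra! hcon
      have h3 := h.powInt_le hp1 fun x => (hcon x).le
      have h4 := h.quadForm_nonneg b
      rw [hf, ← Real.rpow_mul (by have := neg_pos.2 hm; positivity),
        inv_mul_cancel₀ (by linarith), Real.rpow_one, div_mul_cancel₀ _ hlam.ne'] at h3
      have h5 : 1 / (p + 1) * powInt p f ≤ -m / 4 := by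
        rw [one_div, ← div_eq_inv_mul, div_le_iff₀ (by linarith)]
        linarith
      rw [shiftedEnergy] at h1
      linarith
    obtain ⟨x, hx⟩ := hx
    have e0 := integral_add_right_eq_self (μ := volume) (fun y => f y ^ 2) x
    have e2 := integral_add_right_eq_self (μ := volume) (fun y => k y ^ 2) x
    refine ⟨_, _, _, h.comp_add_right x, e0.trans hf,
      e2.le.trans ((hco f g k h hf).2 (by linarith)), by simpa using hx, ?_⟩
    rwa [shiftedEnergy_comp_add_right]
  choose f g k h hf hk h0 hJ using step
  refine ⟨m, hm, hmle, δ, hδ, K, f, g, k, h, hf, hk, h0, ?_⟩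
  have hlim : Tendsto (fun n : ℕ => m + 1 / ((n : ℝ) + 1)) atTop (𝓝 (m + 0)) :=
    tendsto_one_div_add_atTop_nhds_zero_nat.const_add m
  rw [add_zero] at hlim
  exact tendsto_of_tendsto_of_tendsto_of_le_of_le tendsto_const_nhds hlim
    (fun n => hmle _ _ _ (h n) (hf n)) (fun n => (hJ n).le)

theorem exists_minimizer {b p lam : ℝ} (hp1 : 1 < p) (hp9 : p < 9) (hlam : 0 < lam)
    (hneg : ∃ f g k, IsH2 f g k ∧ ∫ x, f x ^ 2 = lam ∧ shiftedEnergy b p f g k < 0) :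
    ∃ f g k, IsH2 f g k ∧ ∫ x, f x ^ 2 = lam ∧ shiftedEnergy b p f g k < 0 ∧
      ∀ f' g' k', IsH2 f' g' k' → ∫ x, f' x ^ 2 = lam →
        shiftedEnergy b p f g k ≤ shiftedEnergy b p f' g' k' := by
  obtain ⟨m, hm0, hm, δ, hδ, K, u, v, w, hu, hmass, hK, hu0, hJ⟩ :=
    exists_minimizing_sequence hp1 hp9 hlam hneg
  obtain ⟨σ, hσ, f, g, k, h, wf, wg, wk, hpt⟩ :=
    IsH2.exists_weak_limit hu (fun n => (hmass n).le) hK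
  have hx : f 0 ≠ 0 := by
    have := ge_of_tendsto' (hpt 0).abs fun n => hu0 (σ n)
    exact abs_pos.1 (hδ.trans_le this)
  have hα := h.integral_sq_pos hx
  have ha := fun n => (hu (σ n)).add (h.const_mul (-1))
  have s0 := tendsto_sq_split (fun n => (hu (σ n)).mem₀) h.mem₀ (wf f h.mem₀)
  have s1 := tendsto_sq_split (fun n => (hu (σ n)).mem₁) h.mem₁ (wg g h.mem₁)
  have s2 := tendsto_sq_split (fun n => (hu (σ n)).mem₂) h.mem₂ (wk k h.mem₂)
  have hβ : Tendsto (fun n => ∫ x, (u (σ n) x + -1 * f x) ^ 2) atTop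
      (𝓝 (lam - ∫ x, f x ^ 2)) := by
    have := s0.const_sub (lam - ∫ x, f x ^ 2)
    rw [sub_zero] at this
    refine this.congr fun n => ?_
    rw [hmass]
    ring
  have hle : ∫ x, f x ^ 2 ≤ lam := by
    have := ge_of_tendsto' hβ fun n => integral_sq_nonneg _
    linarith
  set M := 16 * lam ^ 3 * K + 1
  have huM : ∀ n x, |u n x| ≤ M := fun n x => by
    refine ((hu n).abs_apply_le x).trans ?_
    rw [hmass]
    simp only [M]
    gcongr
    exact hK n
  have hfM : ∀ x, |f x| ≤ M := fun x => le_of_tendsto' (hpt x).abs fun n => huM (σ n) x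
  have hM0 : 0 ≤ M := (abs_nonneg _).trans (hfM 0)
  obtain ⟨B, hB⟩ := hβ.bddAbove_range
  have hN := tendsto_powInt_split (p := p) (M := 2 * M) (B := B) hp1 ha h
    (fun n x => by
      have h1 := huM (σ n) x
      have h2 := hfM x
      have h3 := abs_add_le (u (σ n) x) (-1 * f x)
      rw [neg_one_mul, abs_neg, ← neg_one_mul] at h3
      linarith)
    (fun x => (hfM x).trans (by linarith)) (fun n => hB ⟨n, rfl⟩)
    (fun x => by simpa using (hpt x).add_const (-1 * f x))
  have hsplit : Tendsto (fun n => shiftedEnergy b p (u (σ n)) (v (σ n)) (w (σ n))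
      - shiftedEnergy b p (fun x => u (σ n) x + -1 * f x) (fun x => v (σ n) x + -1 * g x)
          (fun x => w (σ n) x + -1 * k x) - shiftedEnergy b p f g k) atTop (𝓝 0) := by
    have := (((s2.sub (s1.const_mul b)).add (s0.const_mul ((max b 0) ^ 2 / 4))).const_mul
      (1 / 2)).sub (hN.const_mul (1 / (p + 1)))
    simp only [mul_zero, sub_zero, add_zero] at this
    refine this.congr fun n => ?_
    have e : (fun x => u (σ n) x + -1 * f x + f x) = u (σ n) := by
      ext x
      ring
    rw [e]
    simp only [shiftedEnergy, quadForm]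
    ring
  have hlow : shiftedEnergy b p f g k ≤ (∫ x, f x ^ 2) / lam * m := by
    -- The total energy tends to `m`, and the remainder, of mass tending to `lam - ∫ f²`, has at
    -- least its proportional share of `m`; hence `f` has at most its own share.
    have h1 := ((hJ.comp hσ.tendsto_atTop).sub ((hβ.div_const lam).mul_const m)).sub hsplit
    have h2 : m - (lam - ∫ x, f x ^ 2) / lam * m - 0 = (∫ x, f x ^ 2) / lam * m := by
      field_simp
      ring
    rw [h2] at h1
    refine ge_of_tendsto h1 ?_
    filter_upwards [hβ.eventually_lt_const (show lam - ∫ x, f x ^ 2 < lam by linarith)] with n hn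
    have := (ha n).mul_le_shiftedEnergy hp1 hlam hm hn.le
    simp only [Function.comp]
    linarith
  have hfl : ∫ x, f x ^ 2 = lam := by
    rcases hle.eq_or_lt with h1 | h1
    · exact h1
    · exact absurd (h.mul_lt_shiftedEnergy hp1 hlam hm h1 hx) (not_lt.2 hlow)
  rw [hfl, div_self hlam.ne', one_mul] at hlow
  exact ⟨f, g, k, h, hfl, hlow.trans_lt hm0, fun f' g' k' h' hm' => hlow.trans (hm _ _ _ h' hm')⟩

/-! ### Trial functions and negativity of the infimum -/

theorem integral_le_of_support {h : ℝ → ℝ} {E R : ℝ} (hi : Integrable h) (hR : 0 ≤ R)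
    (hE : ∀ x, |x| ≤ R → h x ≤ E) (h0 : ∀ x, R < |x| → h x = 0) : ∫ x, h x ≤ E * (2 * R) := by
  have h1 : ∫ x, h x = ∫ x in Icc (-R) R, h x := by
    rw [setIntegral_eq_integral_of_forall_compl_eq_zero fun x hx => ?_]
    exact h0 x (not_le.1 fun h' => hx (abs_le.1 h'))
  have h2 : ∫ x in Icc (-R) R, h x ≤ ∫ _ in Icc (-R) R, E :=
    setIntegral_mono_on hi.integrableOn (integrableOn_const (by simp)) measurableSet_Icc
      fun x hx => hE x (abs_le.2 hx)
  rw [h1]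
  refine h2.trans (le_of_eq ?_)
  rw [setIntegral_const, Real.volume_real_Icc_of_le (by linarith), smul_eq_mul]
  ring

theorem hasDerivAt_comp_mul_left {β β' : ℝ → ℝ} (h : ∀ x, HasDerivAt β (β' x) x)
    (ε x : ℝ) : HasDerivAt (fun x => β (ε * x)) (ε * β' (ε * x)) x := by
  have h1 : HasDerivAt (fun x : ℝ => ε * x) ε x := by
    simpa using (hasDerivAt_id x).const_mul ε
  rw [mul_comm]
  exact (h (ε * x)).comp x h1

/-- A slowly modulated wave at the frequency minimizing the symbol of the quadratic form. -/
theorem isH2_wave {c s β β' β'' : ℝ → ℝ} {ξ ε : ℝ} (hε : 0 < ε)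
    (hc : ∀ x, HasDerivAt c (ξ * s x) x) (hs : ∀ x, HasDerivAt s (-(ξ * c x)) x)
    (hβ : ∀ x, HasDerivAt β (β' x) x) (hβ' : ∀ x, HasDerivAt β' (β'' x) x)
    (hβ'' : Continuous β'') (h0 : ∀ x, 2 < |x| → β x = 0) (h1 : ∀ x, 2 < |x| → β' x = 0)
    (h2 : ∀ x, 2 < |x| → β'' x = 0) :
    IsH2 (fun x => c x * β (ε * x)) (fun x => ξ * s x * β (ε * x) + c x * (ε * β' (ε * x)))
      (fun x => -(ξ ^ 2 * c x) * β (ε * x) + 2 * ξ * s x * (ε * β' (ε * x))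
        + c x * (ε ^ 2 * β'' (ε * x))) := by
  have cc : Continuous c := continuous_iff_continuousAt.2 fun x => (hc x).continuousAt
  have cs : Continuous s := continuous_iff_continuousAt.2 fun x => (hs x).continuousAt
  have cβ : Continuous β := continuous_iff_continuousAt.2 fun x => (hβ x).continuousAt
  have cβ' : Continuous β' := continuous_iff_continuousAt.2 fun x => (hβ' x).continuousAt
  have far : ∀ x, x ∉ Metric.closedBall (0 : ℝ) (2 / ε) → 2 < |ε * x| := fun x hx => by
    rw [mem_closedBall_zero_iff, not_le, div_lt_iff₀ hε, Real.norm_eq_abs] at hx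
    rwa [abs_mul, abs_of_pos hε, mul_comm]
  have d := fun x => hasDerivAt_comp_mul_left hβ ε x
  have d' := fun x => hasDerivAt_comp_mul_left hβ' ε x
  have ml : ∀ {u : ℝ → ℝ}, Continuous u → (∀ x, 2 < |ε * x| → u x = 0) → MemLp u 2 :=
    fun hu h => hu.memLp_of_hasCompactSupport
      (HasCompactSupport.intro (isCompact_closedBall (0 : ℝ) (2 / ε)) fun x hx => h x (far x hx))
  refine ⟨.of_hasDerivAt (by fun_prop) fun x => ?_, .of_hasDerivAt (by fun_prop) fun x => ?_,
    ml (by fun_prop) fun x hx => ?_, ml (by fun_prop) fun x hx => ?_,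
    ml (by fun_prop) fun x hx => ?_⟩
  · exact (hc x).mul (d x)
  · have := (((hs x).const_mul ξ).mul (d x)).add ((hc x).mul ((d' x).const_mul ε))
    convert! this using 1
    ring
  · rw [h0 _ hx, mul_zero]
  · rw [h0 _ hx, h1 _ hx]
    ring
  · rw [h0 _ hx, h1 _ hx, h2 _ hx]
    ring

theorem exists_bump : ∃ β β' β'' : ℝ → ℝ, (∀ x, HasDerivAt β (β' x) x) ∧
    (∀ x, HasDerivAt β' (β'' x) x) ∧ Continuous β'' ∧ (∀ x, |x| ≤ 1 → β x = 1) ∧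
    (∀ x, 2 < |x| → β x = 0) ∧ (∀ x, 2 < |x| → β' x = 0) ∧ (∀ x, 2 < |x| → β'' x = 0) ∧
    ∃ M, (∀ x, |β' x| ≤ M) ∧ ∀ x, |β'' x| ≤ M := by
  let B : ContDiffBump (0 : ℝ) := ⟨1, 2, by norm_num, by norm_num⟩
  have hB : ContDiff ℝ 2 B := B.contDiff
  have hB' : ContDiff ℝ 1 (deriv B) := by
    have : ContDiff ℝ (1 + 1) B := by norm_num; exact hB
    exact (contDiff_succ_iff_deriv.1 this).2.2
  have c2 : Continuous (deriv (deriv B)) := hB'.continuous_deriv (by norm_num)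
  have ts : ∀ x, 2 < |x| → x ∉ tsupport B := fun x hx h => by
    rw [B.tsupport_eq, mem_closedBall_zero_iff, Real.norm_eq_abs] at h
    exact absurd hx (not_lt.2 h)
  have ts' : ∀ x, 2 < |x| → x ∉ tsupport (deriv B) := fun x hx h =>
    ts x hx (tsupport_deriv_subset h)
  have ts'' : ∀ x, 2 < |x| → x ∉ tsupport (deriv (deriv B)) := fun x hx h =>
    ts' x hx (tsupport_deriv_subset h)
  obtain ⟨M₁, hM₁⟩ := B.hasCompactSupport.deriv.exists_bound_of_continuous hB'.continuous
  obtain ⟨M₂, hM₂⟩ := B.hasCompactSupport.deriv.deriv.exists_bound_of_continuous c2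
  refine ⟨B, deriv B, deriv (deriv B), fun x => (hB.differentiable (by norm_num) x).hasDerivAt,
    fun x => (hB'.differentiable (by norm_num) x).hasDerivAt, c2,
    fun x hx => B.one_of_mem_closedBall (by simpa [B] using hx),
    fun x hx => image_eq_zero_of_notMem_tsupport (ts x hx),
    fun x hx => image_eq_zero_of_notMem_tsupport (ts' x hx),
    fun x hx => image_eq_zero_of_notMem_tsupport (ts'' x hx), max M₁ M₂,
    fun x => (hM₁ x).trans (le_max_left _ _), fun x => (hM₂ x).trans (le_max_right _ _)⟩

/-- Spread-out functions whose quadratic energy is small compared with their mass. -/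
theorem exists_wave (b : ℝ) : ∃ D : ℝ, 0 ≤ D ∧ ∀ ε : ℝ, 0 < ε → ε ≤ 1 → ∃ f g k : ℝ → ℝ,
    IsH2 f g k ∧ 1 / ε ≤ ∫ x, f x ^ 2 ∧ quadForm b f g k ≤ D * ε ∧
      ∀ x, 2 / ε < |x| → f x = 0 := by
  obtain ⟨β, β', β'', hβ, hβ', cβ'', hone, h0, h1, h2, M, hM', hM''⟩ := exists_bump
  have hM : 0 ≤ M := (abs_nonneg _).trans (hM' 0)
  -- The frequency at which the symbol `(ξ² - b₊/2)² + b₋ξ²` vanishes.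
  set ξ := √(max b 0 / 2)
  have hξ : 0 ≤ ξ := Real.sqrt_nonneg _
  have hξ2 : ξ ^ 2 = max b 0 / 2 := Real.sq_sqrt (by positivity)
  set E := (2 * ξ * M + M) ^ 2 + max (-b) 0 * M ^ 2
  refine ⟨4 * E, by positivity, fun ε hε hε1 => ?_⟩
  have far : ∀ x, 2 / ε < |x| → 2 < |ε * x| := fun x hx => by
    rw [div_lt_iff₀ hε] at hx
    rwa [abs_mul, abs_of_pos hε, mul_comm]
  have main : ∀ c s : ℝ → ℝ, (∀ x, HasDerivAt c (ξ * s x) x) →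
      (∀ x, HasDerivAt s (-(ξ * c x)) x) → (∀ x, |c x| ≤ 1) → (∀ x, |s x| ≤ 1) →
      ∃ g k, IsH2 (fun x => c x * β (ε * x)) g k ∧
        quadForm b (fun x => c x * β (ε * x)) g k ≤ 4 * E * ε := by
    intro c s hc hs c1 s1
    have hw := isH2_wave hε hc hs hβ hβ' cβ'' h0 h1 h2
    refine ⟨_, _, hw, ?_⟩
    have i1 : Integrable (fun x => (-(ξ ^ 2 * c x) * β (ε * x) + 2 * ξ * s x * (ε * β' (ε * x))
        + c x * (ε ^ 2 * β'' (ε * x)) + max b 0 / 2 * (c x * β (ε * x))) ^ 2) :=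
      integrable_sq (hw.mem₂.add (hw.mem₀.const_mul (max b 0 / 2)))
    have i2 := (integrable_sq hw.mem₁).const_mul (max (-b) 0)
    rw [hw.quadForm_eq, ← integral_const_mul, ← integral_add i1 i2]
    refine (integral_le_of_support (E := E * ε ^ 2) (R := 2 / ε) (i1.add i2) (by positivity)
      (fun x _ => ?_) (fun x hx => ?_)).trans (le_of_eq ?_)
    · simp only [Pi.add_apply]
      -- The terms of order one cancel because `ξ² = b₊/2`; what remains has a factor `ε`.
      have e1 : -(ξ ^ 2 * c x) * β (ε * x) + 2 * ξ * s x * (ε * β' (ε * x))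
          + c x * (ε ^ 2 * β'' (ε * x)) + max b 0 / 2 * (c x * β (ε * x))
          = ε * (2 * ξ * (s x * β' (ε * x)) + ε * (c x * β'' (ε * x))) := by
        rw [← hξ2]
        ring
      have p1 : |s x * β' (ε * x)| ≤ M := by
        rw [abs_mul]
        exact (mul_le_of_le_one_left (abs_nonneg _) (s1 x)).trans (hM' _)
      have p2 : |c x * β'' (ε * x)| ≤ M := by
        rw [abs_mul]
        exact (mul_le_of_le_one_left (abs_nonneg _) (c1 x)).trans (hM'' _)
      have p3 : |c x * β' (ε * x)| ≤ M := by
        rw [abs_mul]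
        exact (mul_le_of_le_one_left (abs_nonneg _) (c1 x)).trans (hM' _)
      have q1 : |2 * ξ * (s x * β' (ε * x)) + ε * (c x * β'' (ε * x))| ≤ 2 * ξ * M + M := by
        refine (abs_add_le _ _).trans (add_le_add ?_ ?_)
        · rw [abs_mul, abs_of_nonneg (by positivity : 0 ≤ 2 * ξ)]
          gcongr
        · rw [abs_mul, abs_of_pos hε]
          exact (mul_le_of_le_one_left (abs_nonneg _) hε1).trans p2
      have q2 : max (-b) 0 * (ξ * s x * β (ε * x) + c x * (ε * β' (ε * x))) ^ 2
          ≤ max (-b) 0 * M ^ 2 * ε ^ 2 := by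
        -- Either `ξ = 0` and the first derivative falls only on the envelope, or the coefficient
        -- `b₋` is zero.
        rcases le_total b 0 with hb | hb
        · have : ξ = 0 := by simp [ξ, hb]
          rw [this]
          have := sq_le_sq' (abs_le.1 p3).1 (abs_le.1 p3).2
          have e2 : (0 * s x * β (ε * x) + c x * (ε * β' (ε * x))) ^ 2
            = ε ^ 2 * (c x * β' (ε * x)) ^ 2 := by ring
          rw [e2, mul_assoc, mul_comm (ε ^ 2)]
          gcongr
        · simp [hb]
      rw [e1, mul_pow]
      have q3 := sq_le_sq' (abs_le.1 q1).1 (abs_le.1 q1).2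
      have q4 := mul_le_mul_of_nonneg_left q3 (sq_nonneg ε)
      simp only [E]
      linarith
    · have hx' := far x hx
      simp only [Pi.add_apply, h0 _ hx', h1 _ hx', h2 _ hx']
      ring
    · field_simp
      ring
  have dl : ∀ x : ℝ, HasDerivAt (fun x => ξ * x) ξ x := fun x => by
    simpa using (hasDerivAt_id x).const_mul ξ
  have dcos : ∀ x, HasDerivAt (fun x => Real.cos (ξ * x)) (ξ * -Real.sin (ξ * x)) x := fun x => by
    convert! (dl x).cos using 1
    ring
  have dsin : ∀ x, HasDerivAt (fun x => Real.sin (ξ * x)) (ξ * Real.cos (ξ * x)) x := fun x => by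
    convert! (dl x).sin using 1
    ring
  obtain ⟨g₁, k₁, hw₁, hq₁⟩ := main (fun x => Real.cos (ξ * x)) (fun x => -Real.sin (ξ * x))
    dcos (fun x => (dsin x).neg) (fun x => Real.abs_cos_le_one _)
    (fun x => by rw [abs_neg]; exact Real.abs_sin_le_one _)
  obtain ⟨g₂, k₂, hw₂, hq₂⟩ := main (fun x => Real.sin (ξ * x)) (fun x => Real.cos (ξ * x))
    dsin (fun x => by simpa using dcos x) (fun x => Real.abs_sin_le_one _)
    (fun x => Real.abs_cos_le_one _)
  -- Since `cos² + sin² = 1`, the two masses add up to at least `2/ε`, so one of the two waves has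
  -- mass at least `1/ε`. No oscillatory integral is needed.
  have hsum : 2 / ε ≤ (∫ x, (Real.cos (ξ * x) * β (ε * x)) ^ 2)
      + ∫ x, (Real.sin (ξ * x) * β (ε * x)) ^ 2 := by
    have i1 := integrable_sq hw₁.mem₀
    have i2 := integrable_sq hw₂.mem₀
    rw [← integral_add i1 i2]
    refine le_trans (le_of_eq ?_) (setIntegral_le_integral (s := Icc (-(1 / ε)) (1 / ε)) (i1.add i2)
      (ae_of_all _ fun x => add_nonneg (sq_nonneg _) (sq_nonneg _)))
    have : ∫ x in Icc (-(1 / ε)) (1 / ε), ((fun x => (Real.cos (ξ * x) * β (ε * x)) ^ 2)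
        + fun x => (Real.sin (ξ * x) * β (ε * x)) ^ 2) x = ∫ x in Icc (-(1 / ε)) (1 / ε), 1 := by
      refine setIntegral_congr_fun measurableSet_Icc fun x hx => ?_
      have : β (ε * x) = 1 := hone _ <| by
        rw [abs_mul, abs_of_pos hε]
        have := (le_div_iff₀ hε).1 (abs_le.2 hx)
        linarith
      simp [this]
    refine Eq.trans ?_ this.symm
    rw [setIntegral_const, Real.volume_real_Icc_of_le (by have : 0 < 1 / ε := by positivity
                                                          linarith), smul_eq_mul]
    ring
  have e2 : 2 / ε = 1 / ε + 1 / ε := by ring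
  rcases le_or_gt (1 / ε) (∫ x, (Real.cos (ξ * x) * β (ε * x)) ^ 2) with h | h
  · exact ⟨_, g₁, k₁, hw₁, h, hq₁, fun x hx => by rw [h0 _ (far x hx), mul_zero]⟩
  · exact ⟨_, g₂, k₂, hw₂, by linarith, hq₂, fun x hx => by rw [h0 _ (far x hx), mul_zero]⟩

/-- Jensen's inequality for a function supported in `[-R, R]`. -/
theorem IsH2.le_powInt {f g k : ℝ → ℝ} {p R : ℝ} (h : IsH2 f g k) (hp : 1 < p) (hR : 0 < R)
    (hm : 0 < ∫ x, f x ^ 2) (h0 : ∀ x, R < |x| → f x = 0) :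
    ((∫ x, f x ^ 2) / (2 * R)) ^ ((p + 1) / 2) * (2 * R) ≤ powInt p f := by
  set A := (∫ x, f x ^ 2) / (2 * R) with hA
  have hA0 : 0 < A := by positivity
  set r := (p + 1) / 2 with hr
  have i1 := h.integrable_abs_rpow hp
  have i2 := (integrable_sq h.mem₀).const_mul (A ^ r * r / A)
  -- Bernoulli's inequality: the tangent line to `t ^ r` at the mean `A` of `f²`, to be integrated
  -- over `[-R, R]`.
  have pt : ∀ x, A ^ r * (1 - r) + A ^ r * r / A * f x ^ 2 ≤ |f x| ^ (p + 1) := fun x => by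
    have h1 := one_add_mul_self_le_rpow_one_add (s := f x ^ 2 / A - 1) (p := r)
      (by have : 0 ≤ f x ^ 2 / A := by positivity
          linarith) (by simp only [r]; linarith)
    rw [add_sub_cancel, Real.div_rpow (sq_nonneg _) hA0.le, le_div_iff₀ (by positivity)] at h1
    have e : (f x ^ 2) ^ r = |f x| ^ (p + 1) := by
      rw [← sq_abs, ← Real.rpow_natCast, ← Real.rpow_mul (abs_nonneg _)]
      congr 1
      simp only [r]
      push_cast
      ring
    rw [e] at h1
    refine le_trans (le_of_eq ?_) h1
    ring
  have h1 := integral_le_of_support (h := fun x => A ^ r * r / A * f x ^ 2 - |f x| ^ (p + 1))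
    (E := -(A ^ r * (1 - r))) (i2.sub i1) hR.le (fun x _ => by linarith [pt x])
    (fun x hx => by simp [h0 x hx, (by linarith : p + 1 ≠ 0)])
  rw [integral_sub i2 i1, integral_const_mul] at h1
  have h2 : A ^ r * r / A * ∫ x, f x ^ 2 = A ^ r * r * (2 * R) := by
    rw [hA]
    field_simp
  rw [h2] at h1
  rw [powInt]
  linarith

/-- The wave is rescaled to mass `lam`. As its original mass is at least `1/ε`, its quadratic form
is at most `lam D ε²`; its square has mean `lam ε/4` over `[-2/ε, 2/ε]`, to which Jensen applies. -/
theorem exists_shiftedEnergy_le (b : ℝ) : ∃ D : ℝ, 0 ≤ D ∧ ∀ p lam ε : ℝ, 1 < p → 0 < lam → 0 < ε →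
    ε ≤ 1 → ∃ f g k, IsH2 f g k ∧ ∫ x, f x ^ 2 = lam ∧ shiftedEnergy b p f g k
      ≤ lam * (1 / 2 * D * ε ^ 2 - 1 / (p + 1) * (lam * ε / 4) ^ ((p - 1) / 2)) := by
  obtain ⟨D, hD, hw⟩ := exists_wave b
  refine ⟨D, hD, fun p lam ε hp hlam hε hε1 => ?_⟩
  obtain ⟨f, g, k, h, hm, hq, h0⟩ := hw ε hε hε1
  have hm0 : 0 < ∫ x, f x ^ 2 := lt_of_lt_of_le (by positivity) hm
  have hN := h.le_powInt hp (by positivity) hm0 h0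
  set μ := ∫ x, f x ^ 2 with hμ
  have hθ : 0 ≤ lam / μ := by positivity
  refine ⟨_, _, _, h.const_mul √(lam / μ), ?_, ?_⟩
  · rw [integral_const_mul_sq, Real.sq_sqrt hθ, ← hμ]
    field_simp
  · rw [shiftedEnergy_sqrt_mul hθ]
    have h1 : lam / μ * (1 / 2 * quadForm b f g k) ≤ lam * (1 / 2 * D * ε ^ 2) := by
      have : D * ε ≤ D * ε ^ 2 * μ := by
        have : 1 ≤ ε * μ := by
          rw [div_le_iff₀ hε] at hm
          linarith
        calc D * ε = D * ε * 1 := by ring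
          _ ≤ D * ε * (ε * μ) := by gcongr
          _ = _ := by ring
      calc lam / μ * (1 / 2 * quadForm b f g k) ≤ lam / μ * (1 / 2 * (D * ε ^ 2 * μ)) := by
            gcongr
            exact hq.trans this
        _ = _ := by field_simp
    have h2 : lam * (lam * ε / 4) ^ ((p - 1) / 2) ≤ (lam / μ) ^ ((p + 1) / 2) * powInt p f := by
      refine le_trans (le_of_eq ?_) (mul_le_mul_of_nonneg_left hN (by positivity))
      rw [← mul_assoc, ← Real.mul_rpow hθ (by positivity)]
      have e1 : lam / μ * (μ / (2 * (2 / ε))) = lam * ε / 4 := by field_simp; ring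
      rw [e1, show (p + 1) / 2 = (p - 1) / 2 + 1 by ring, Real.rpow_add_one (by positivity)]
      field_simp
      ring
    have h3 : 1 / (p + 1) * (lam * (lam * ε / 4) ^ ((p - 1) / 2))
        ≤ 1 / (p + 1) * ((lam / μ) ^ ((p + 1) / 2) * powInt p f) := by gcongr
    linarith

/-- Above a threshold mass, which vanishes for `p < 5`, the infimum of the shifted energy is
negative. -/
theorem exists_threshold (b : ℝ) {p : ℝ} (hp : 1 < p) : ∃ lam₀ : ℝ, 0 ≤ lam₀ ∧ (p < 5 → lam₀ = 0) ∧
    ∀ lam, lam₀ < lam →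
      ∃ f g k, IsH2 f g k ∧ ∫ x, f x ^ 2 = lam ∧ shiftedEnergy b p f g k < 0 := by
  obtain ⟨D, hD, hex⟩ := exists_shiftedEnergy_le b
  have reduce : ∀ lam ε : ℝ, 0 < lam → 0 < ε → ε ≤ 1 →
      1 / 2 * D * ε ^ 2 < 1 / (p + 1) * (lam * ε / 4) ^ ((p - 1) / 2) →
      ∃ f g k, IsH2 f g k ∧ ∫ x, f x ^ 2 = lam ∧ shiftedEnergy b p f g k < 0 := by
    intro lam ε hlam hε hε1 hlt
    obtain ⟨f, g, k, h, hm, hJ⟩ := hex p lam ε hp hlam hε hε1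
    exact ⟨f, g, k, h, hm, hJ.trans_lt (mul_neg_of_pos_of_neg hlam (by linarith))⟩
  by_cases hp5 : p < 5
  · refine ⟨0, le_rfl, fun _ => rfl, fun lam hlam => ?_⟩
    -- Dividing `ε²` by `ε^((p-1)/2)` leaves `ε^((5-p)/2)`, which tends to `0` because `p < 5`.
    have hlim : Tendsto (fun ε : ℝ => 1 / 2 * D * ε ^ ((5 - p) / 2)) (𝓝 0) (𝓝 0) := by
      have := ((Real.continuousAt_rpow_const 0 ((5 - p) / 2)
        (Or.inr (by linarith))).tendsto).const_mul (1 / 2 * D)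
      rwa [Real.zero_rpow (by linarith), mul_zero] at this
    have hc : 0 < 1 / (p + 1) * (lam / 4) ^ ((p - 1) / 2) := by positivity
    have ev := ((hlim.eventually_lt_const hc).filter_mono nhdsWithin_le_nhds).and
      (Ioc_mem_nhdsGT (zero_lt_one' ℝ))
    obtain ⟨ε, hε, hε0, hε1⟩ := ev.exists
    refine reduce lam ε hlam hε0 hε1 ?_
    have e1 : ε ^ 2 = ε ^ ((5 - p) / 2) * ε ^ ((p - 1) / 2) := by
      rw [← Real.rpow_add hε0, ← Real.rpow_natCast]
      congr 1
      push_cast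
      ring
    have e2 : (lam * ε / 4) ^ ((p - 1) / 2) = (lam / 4) ^ ((p - 1) / 2) * ε ^ ((p - 1) / 2) := by
      rw [← Real.mul_rpow (by positivity) hε0.le]
      congr 1
      ring
    rw [e1, e2, ← mul_assoc, ← mul_assoc]
    exact mul_lt_mul_of_pos_right hε (by positivity)
  · set X := (p + 1) * (1 / 2 * D)
    have hX : 0 ≤ X := by positivity
    -- The mass at which the two terms balance for `ε = 1`.
    refine ⟨4 * X ^ (2 / (p - 1)), by positivity, fun h => absurd h hp5, fun lam hlam => ?_⟩
    have hlam0 : 0 < lam := lt_of_le_of_lt (by positivity) hlam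
    refine reduce lam 1 hlam0 one_pos le_rfl ?_
    have h1 : X ^ (2 / (p - 1)) < lam * 1 / 4 := by linarith
    have h2 := Real.rpow_lt_rpow (by positivity) h1 (z := (p - 1) / 2) (by linarith)
    rw [← Real.rpow_mul hX, show 2 / (p - 1) * ((p - 1) / 2) = 1 by
      have : p - 1 ≠ 0 := by linarith
      field_simp, Real.rpow_one] at h2
    rw [one_pow, mul_one, one_div (p + 1), ← div_eq_inv_mul, lt_div_iff₀ (by linarith)]
    simp only [X] at h2
    linarith

/-! ### The Euler–Lagrange equation -/

/-- The tangent line inequality for the convex function `|·|^(p+1)`. -/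
theorem abs_rpow_add_le {p : ℝ} (hp : 1 < p) (a y : ℝ) :
    |a| ^ (p + 1) + (p + 1) * (|a| ^ (p - 1) * a * y) ≤ |a + y| ^ (p + 1) := by
  rcases eq_or_ne a 0 with rfl | ha
  · simp only [abs_zero, mul_zero, zero_mul, zero_add, Real.zero_rpow (by linarith : p + 1 ≠ 0)]
    positivity
  have ha' : 0 < |a| := abs_pos.2 ha
  -- Bernoulli's inequality at the ratio `|a + y|/|a|`; the sign is then recovered from `|a||a + y|
  -- ≥ a(a + y)`.
  have h1 := one_add_mul_self_le_rpow_one_add (s := |a + y| / |a| - 1) (p := p + 1)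
    (by have : 0 ≤ |a + y| / |a| := by positivity
        linarith) (by linarith)
  rw [add_sub_cancel, Real.div_rpow (abs_nonneg _) ha'.le, le_div_iff₀ (by positivity)] at h1
  refine le_trans ?_ h1
  have e1 : |a| ^ (p + 1) = |a| ^ (p - 1) * (|a| * |a|) := by
    rw [← mul_assoc, ← Real.rpow_add_one ha'.ne', ← Real.rpow_add_one ha'.ne']
    ring_nf
  have e2 : (1 + (p + 1) * (|a + y| / |a| - 1)) * |a| ^ (p + 1)
      = |a| ^ (p + 1) + (p + 1) * (|a| ^ (p - 1) * (|a| * |a + y| - |a| * |a|)) := by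
    rw [e1]
    field_simp
  rw [e2, mul_assoc (|a| ^ (p - 1))]
  gcongr
  rw [abs_mul_abs_self, ← abs_mul]
  have := le_abs_self (a * (a + y))
  linarith

theorem continuous_abs_rpow_mul {p : ℝ} (hp : 1 < p) {f : ℝ → ℝ} (hf : Continuous f) :
    Continuous (fun x => |f x| ^ (p - 1) * f x) :=
  (hf.abs.rpow_const fun _ => Or.inr (by linarith)).mul hf

theorem isH2_test {η : ℝ → ℝ} (hη : ContDiff ℝ (⊤ : ℕ∞) η) (hc : HasCompactSupport η) :
    IsH2 η (deriv η) (deriv (deriv η)) := by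
  have h1 : ContDiff ℝ (⊤ : ℕ∞) (deriv η) := (contDiff_infty_iff_deriv.1 hη).2
  have h2 : ContDiff ℝ (⊤ : ℕ∞) (deriv (deriv η)) := (contDiff_infty_iff_deriv.1 h1).2
  exact ⟨.of_hasDerivAt h1.continuous fun x => (hη.differentiable (by simp) x).hasDerivAt,
    .of_hasDerivAt h2.continuous fun x => (h1.differentiable (by simp) x).hasDerivAt,
    hη.continuous.memLp_of_hasCompactSupport hc,
    h1.continuous.memLp_of_hasCompactSupport hc.deriv,
    h2.continuous.memLp_of_hasCompactSupport hc.deriv.deriv⟩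

/-- A lower bound affine in `t` and exact at `t = 0` suffices for the variational argument and
avoids differentiating under the integral. -/
theorem powInt_add_le {p : ℝ} (hp : 1 < p) {f g k η : ℝ → ℝ} (h : IsH2 f g k)
    (hη : ContDiff ℝ (⊤ : ℕ∞) η) (hc : HasCompactSupport η) (t : ℝ) :
    powInt p f + (p + 1) * (t * ∫ x, |f x| ^ (p - 1) * f x * η x)
      ≤ powInt p (fun x => f x + t * η x) := by
  have i1 := h.integrable_abs_rpow hp
  have i2 : Integrable (fun x => |f x| ^ (p - 1) * f x * η x) :=
    ((continuous_abs_rpow_mul hp h.prim₁.continuous).mul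
      hη.continuous).integrable_of_hasCompactSupport hc.mul_left
  have i3 := (h.add ((isH2_test hη hc).const_mul t)).integrable_abs_rpow hp
  rw [powInt, powInt, ← integral_const_mul, ← integral_const_mul,
    ← integral_add i1 ((i2.const_mul t).const_mul (p + 1))]
  refine integral_mono (i1.add ((i2.const_mul t).const_mul (p + 1))) i3 fun x => ?_
  refine le_trans (le_of_eq ?_) (abs_rpow_add_le hp (f x) (t * η x))
  ring

/-- The Euler-Lagrange equation in weak form. -/
theorem euler_lagrange_weak {b p lam : ℝ} (hp : 1 < p) (hlam : 0 < lam) {f g k : ℝ → ℝ}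
    (h : IsH2 f g k) (hm : ∫ x, f x ^ 2 = lam)
    (hmin : ∀ f' g' k', IsH2 f' g' k' → ∫ x, f' x ^ 2 = lam →
        shiftedEnergy b p f g k ≤ shiftedEnergy b p f' g' k')
    {η : ℝ → ℝ} (hη : ContDiff ℝ (⊤ : ℕ∞) η) (hc : HasCompactSupport η) :
    (∫ x, k x * deriv (deriv η) x) - b * (∫ x, g x * deriv η x)
      + ((max b 0) ^ 2 / 4 + (powInt p f - quadForm b f g k) / lam) * (∫ x, f x * η x)
      - ∫ x, |f x| ^ (p - 1) * f x * η x = 0 := by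
  have hη2 := isH2_test hη hc
  set N := powInt p f with hN
  set T := quadForm b f g k with hT
  set P := ∫ x, |f x| ^ (p - 1) * f x * η x
  set Q := ∫ x, f x * η x with hQ
  set c := (max b 0) ^ 2 / 4
  set S := (∫ x, k x * deriv (deriv η) x) - b * (∫ x, g x * deriv η x) + c * Q with hS
  set T' := quadForm b η (deriv η) (deriv (deriv η)) with hT'
  set E := ∫ x, η x ^ 2
  set ρ : ℝ → ℝ := fun t => lam / (lam + 2 * t * Q + t ^ 2 * E) with hρ
  -- `ρ t` rescales `f + tη` to mass `lam`. With the power integral replaced by its affine lower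
  -- bound, `G` lies above the rescaled energy near `0` and equals the minimum at `0`, so `0` is a
  -- local minimum of an explicit function.
  set G : ℝ → ℝ := fun t => ρ t * (1 / 2 * (T + 2 * t * S + t ^ 2 * T'))
    - ρ t ^ ((p + 1) / 2) * (1 / (p + 1) * (N + (p + 1) * (t * P))) with hG
  have quad : ∀ t, quadForm b (fun x => f x + t * η x) (fun x => g x + t * deriv η x)
      (fun x => k x + t * deriv (deriv η) x) = T + 2 * t * S + t ^ 2 * T' := by
    intro t
    rw [quadForm, integral_add_mul_sq h.mem₀ hη2.mem₀, integral_add_mul_sq h.mem₁ hη2.mem₁,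
      integral_add_mul_sq h.mem₂ hη2.mem₂, hT, hS, hT', quadForm, quadForm]
    ring
  have mass : ∀ t, ∫ x, (f x + t * η x) ^ 2 = lam + 2 * t * Q + t ^ 2 * E := by
    intro t
    rw [integral_add_mul_sq h.mem₀ hη2.mem₀, hm]
  have hcont : Continuous fun t : ℝ => lam + 2 * t * Q + t ^ 2 * E := by fun_prop
  have ev : ∀ᶠ t in 𝓝 (0 : ℝ), 0 < lam + 2 * t * Q + t ^ 2 * E := by
    refine (hcont.tendsto 0).eventually_const_lt ?_
    simpa using hlam
  have hρ0 : ρ 0 = 1 := by simp [hρ, hlam.ne']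
  have hmn : IsLocalMin G 0 := by
    filter_upwards [ev] with t ht
    have e0 : G 0 = shiftedEnergy b p f g k := by
      simp only [hG, hρ0, Real.one_rpow, shiftedEnergy]
      ring
    rw [e0]
    have h1 := (h.add (hη2.const_mul t)).le_scaled_shiftedEnergy (b := b) (p := p) hlam hmin
      (by rw [mass]; exact ht)
    rw [mass, quad] at h1
    refine h1.trans ?_
    have h2 := powInt_add_le hp h hη hc t
    have hρt : 0 ≤ ρ t := by simp only [hρ]; positivity
    simp only [hG]
    gcongr
  have d0 : HasDerivAt (fun t : ℝ => lam + 2 * t * Q + t ^ 2 * E) (2 * Q) 0 := by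
    have := ((((hasDerivAt_id (0 : ℝ)).const_mul 2).mul_const Q).const_add lam).add
      (((hasDerivAt_id (0 : ℝ)).pow 2).mul_const E)
    convert! this using 1
    simp
  have dρ : HasDerivAt ρ (-(2 * Q / lam)) 0 := by
    have := (hasDerivAt_const (0 : ℝ) lam).div d0 (by simpa using hlam.ne')
    convert! this using 1
    simp
    field_simp
  have dT : HasDerivAt (fun t : ℝ => 1 / 2 * (T + 2 * t * S + t ^ 2 * T')) S 0 := by
    have := (((((hasDerivAt_id (0 : ℝ)).const_mul 2).mul_const S).const_add T).add
      (((hasDerivAt_id (0 : ℝ)).pow 2).mul_const T')).const_mul (1 / 2)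
    convert! this using 1
    simp
  have dN : HasDerivAt (fun t : ℝ => 1 / (p + 1) * (N + (p + 1) * (t * P))) P 0 := by
    have := ((((hasDerivAt_id (0 : ℝ)).mul_const P).const_mul (p + 1)).const_add N).const_mul
      (1 / (p + 1))
    convert! this using 1
    have : p + 1 ≠ 0 := by linarith
    field_simp
  have dr : HasDerivAt (fun t => ρ t ^ ((p + 1) / 2)) (-(2 * Q / lam) * ((p + 1) / 2)) 0 := by
    have := dρ.rpow_const (p := (p + 1) / 2) (Or.inl (by rw [hρ0]; norm_num))
    simpa [hρ0] using this
  have dG := (dρ.mul dT).sub (dr.mul dN)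
  have hz := hmn.hasDerivAt_eq_zero dG
  simp only [hρ0, Real.one_rpow] at hz
  have hp0 : p + 1 ≠ 0 := by linarith
  have hz' : -(Q / lam) * T + S + (Q / lam) * N - P = 0 := by
    rw [← hz]
    field_simp
    ring
  have : ((∫ x, k x * deriv (deriv η) x) - b * ∫ x, g x * deriv η x) = S - c * Q := by
    rw [hS]
    ring
  rw [this, ← hz']
  ring

/-! ### Regularity -/

/-- If `k'' = h` in the sense of distributions, then `k` is weakly differentiable and its
derivative is a primitive of `h`. -/
theorem exists_isPrimitive_of_second_deriv {k h : ℝ → ℝ} (hk : LocallyIntegrable k)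
    (hh : LocallyIntegrable h)
    (hw : ∀ η : ℝ → ℝ, ContDiff ℝ (⊤ : ℕ∞) η → HasCompactSupport η →
      ∫ x, k x * deriv (deriv η) x = ∫ x, h x * η x) :
    ∃ l, IsPrimitive l h ∧ IsWeakDeriv k l := by
  obtain ⟨χ, hχ, hχc, hχ1⟩ := exists_test_integral_eq_one
  have hW := isPrimitive_integral hh 0 0
  set W : ℝ → ℝ := fun x => 0 + ∫ t in (0 : ℝ)..x, h t
  have hWl : LocallyIntegrable W := hW.continuous.locallyIntegrable
  -- The constant for which `W - c` passes the weak derivative test against `χ`; other test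
  -- functions reduce to `χ` and a derivative.
  set c := (∫ x, k x * deriv χ x) + ∫ x, W x * χ x with hc
  refine ⟨fun x => W x - c, ⟨hh, fun x y => by rw [← hW.2]; ring⟩, hk,
    (hW.continuous.sub continuous_const).locallyIntegrable, fun ψ hψ hψc => ?_⟩
  obtain ⟨η, hη, hηc, hηd⟩ := exists_deriv_eq_sub hχ hχc hχ1 hψ hψc
  have e1 := hw η hη hηc
  have e2 := hW.isWeakDeriv.2.2 η hη hηc
  have hdd : deriv (deriv η) = fun x => deriv ψ x - (∫ y, ψ y) * deriv χ x := by
    rw [hηd]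
    ext x
    exact ((hψ.differentiable (by simp) x).hasDerivAt.sub
      ((hχ.differentiable (by simp) x).hasDerivAt.const_mul _)).deriv
  have i1 := integrable_mul_test hk (hψ.continuous_deriv (by simp)) hψc.deriv
  have i2 := integrable_mul_test hk (hχ.continuous_deriv (by simp)) hχc.deriv
  have i3 := integrable_mul_test hWl hψ.continuous hψc
  have i4 := integrable_mul_test hWl hχ.continuous hχc
  have iψ : Integrable ψ := hψ.continuous.integrable_of_hasCompactSupport hψc
  rw [hdd] at e1
  rw [hηd] at e2
  have s1 : ∀ x, k x * (deriv ψ x - (∫ y, ψ y) * deriv χ x)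
      = k x * deriv ψ x - (∫ y, ψ y) * (k x * deriv χ x) := fun x => by ring
  have s2 : ∀ x, W x * (ψ x - (∫ y, ψ y) * χ x)
      = W x * ψ x - (∫ y, ψ y) * (W x * χ x) := fun x => by ring
  simp only [s1] at e1
  simp only [s2] at e2
  rw [integral_sub i1 (i2.const_mul _), integral_const_mul] at e1
  rw [integral_sub i3 (i4.const_mul _), integral_const_mul] at e2
  simp only [sub_mul]
  rw [integral_sub i3 (iψ.const_mul c), integral_const_mul]
  have : (∫ x, k x * deriv χ x) = c - ∫ x, W x * χ x := by rw [hc]; ring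
  rw [this] at e1
  linarith

/-- The moving integral is the convolution of `u` with the indicator of `(-1, 0]`. -/
theorem integrable_integral_unit {u : ℝ → ℝ} (hu : Integrable u) :
    Integrable (fun x => ∫ t in x..(x + 1), u t) := by
  have h1 : Integrable ((Ioc (-1 : ℝ) 0).indicator fun _ => (1 : ℝ)) :=
    (integrable_indicator_iff measurableSet_Ioc).2 (integrableOn_const (by simp))
  have h2 := h1.integrable_convolution (ContinuousLinearMap.mul ℝ ℝ) hu
  refine h2.congr (ae_of_all _ fun x => ?_)
  have e : ∀ t, (ContinuousLinearMap.mul ℝ ℝ)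
      ((Ioc (-1 : ℝ) 0).indicator (fun _ => (1 : ℝ)) t) (u (x - t))
      = (Ioc (-1 : ℝ) 0).indicator (fun t => u (x - t)) t := fun t => by
    by_cases ht : t ∈ Ioc (-1 : ℝ) 0 <;> simp [ht]
  simp only [convolution_def, e]
  rw [integral_indicator measurableSet_Ioc, ← intervalIntegral.integral_of_le (by norm_num),
    intervalIntegral.integral_comp_sub_left]
  simp

/-- If `k` and `k''` are square integrable, then so is `k'`. -/
theorem memLp_of_isPrimitive {k l h : ℝ → ℝ} (hkl : IsPrimitive k l) (hlh : IsPrimitive l h)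
    (mk : MemLp k 2) (mh : MemLp h 2) : MemLp l 2 := by
  rw [memLp_two_iff_integrable_sq hlh.continuous.aestronglyMeasurable]
  have ik := integrable_sq mk
  have i1 : Integrable (fun x => k (x + 1) ^ 2) := ik.comp_add_right 1
  have i2 := integrable_integral_unit (integrable_sq mh)
  refine (((i1.add ik).add i2).const_mul 3).mono'
    (hlh.continuous.pow 2).aestronglyMeasurable (ae_of_all _ fun x => ?_)
  rw [Real.norm_of_nonneg (sq_nonneg _)]
  simp only [Pi.add_apply]
  -- Taylor's formula with integral remainder gives `l x = k (x + 1) - k x - I`; squaring the three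
  -- terms costs the factor `3`.
  have hd : IsPrimitive (fun y : ℝ => x + 1 - y) (fun _ => -1) :=
    .of_hasDerivAt continuous_const fun y => (hasDerivAt_id y).const_sub (x + 1)
  have e1 := (hd.mul hlh).2 x (x + 1)
  have j1 : IntervalIntegrable (fun y => -1 * l y) volume x (x + 1) :=
    (hlh.continuous.intervalIntegrable _ _).const_mul (-1)
  have j2 : IntervalIntegrable (fun y => (x + 1 - y) * h y) volume x (x + 1) :=
    (hlh.1.intervalIntegrable _ _).continuousOn_mul (by fun_prop)
  rw [intervalIntegral.integral_add j1 j2, intervalIntegral.integral_const_mul, ← hkl.2] at e1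
  set I := ∫ y in x..(x + 1), (x + 1 - y) * h y with hI
  have hI2 : I ^ 2 ≤ ∫ t in x..(x + 1), h t ^ 2 := by
    have m1 : MemLp ((Ioc x (x + 1)).indicator h) 2 := mh.indicator measurableSet_Ioc
    have m2 : MemLp ((Ioc x (x + 1)).indicator fun y => x + 1 - y) 2 := by
      rw [memLp_indicator_iff_restrict measurableSet_Ioc]
      refine MemLp.of_bound (by fun_prop) 1 ?_
      refine (ae_restrict_iff' measurableSet_Ioc).2 (ae_of_all _ fun y hy => ?_)
      rw [Real.norm_eq_abs, abs_le]
      exact ⟨by linarith [hy.2], by linarith [hy.1]⟩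
    have cs := sq_integral_mul_le m2 m1
    have c1 : ∫ y, (Ioc x (x + 1)).indicator (fun y => x + 1 - y) y * (Ioc x (x + 1)).indicator h y
        = I := by
      rw [hI, intervalIntegral.integral_of_le (by linarith),
        ← integral_indicator measurableSet_Ioc]
      congr 1
      ext y
      by_cases hy : y ∈ Ioc x (x + 1) <;> simp [hy]
    have c2 : ∫ y, (Ioc x (x + 1)).indicator h y ^ 2 = ∫ t in x..(x + 1), h t ^ 2 := by
      rw [intervalIntegral.integral_of_le (by linarith), ← integral_indicator measurableSet_Ioc]
      congr 1
      ext y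
      by_cases hy : y ∈ Ioc x (x + 1) <;> simp [hy]
    have c3 : ∫ y, (Ioc x (x + 1)).indicator (fun y => x + 1 - y) y ^ 2 ≤ 1 := by
      have : ∫ y, (Ioc x (x + 1)).indicator (fun _ => (1 : ℝ)) y = 1 := by
        rw [integral_indicator measurableSet_Ioc, setIntegral_const,
          Real.volume_real_Ioc_of_le (by linarith)]
        simp
      refine (integral_mono (integrable_sq m2)
        ((integrable_indicator_iff measurableSet_Ioc).2 (integrableOn_const (by simp)))
        fun y => ?_).trans this.le
      by_cases hy : y ∈ Ioc x (x + 1)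
      · simp only [hy, indicator_of_mem]
        nlinarith [hy.1, hy.2]
      · simp [hy]
    rw [c1, c2] at cs
    have : 0 ≤ ∫ t in x..(x + 1), h t ^ 2 :=
      intervalIntegral.integral_nonneg (by linarith) fun t _ => sq_nonneg _
    nlinarith
  have e2 : l x = k (x + 1) - k x - I := by linarith
  rw [e2]
  nlinarith [sq_nonneg (k (x + 1) + k x), sq_nonneg (k (x + 1) + I), sq_nonneg (k x - I)]

theorem memLp_abs_rpow_mul {f g k : ℝ → ℝ} {p : ℝ} (hp : 1 < p) (h : IsH2 f g k) :
    MemLp (fun x => |f x| ^ (p - 1) * f x) 2 := by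
  refine h.mem₀.of_le_mul (c := ((16 * (∫ t, f t ^ 2) ^ 3 * ∫ t, k t ^ 2) + 1) ^ (p - 1))
    (continuous_abs_rpow_mul hp h.prim₁.continuous).aestronglyMeasurable
    (ae_of_all _ fun x => ?_)
  rw [norm_mul, Real.norm_of_nonneg (Real.rpow_nonneg (abs_nonneg _) _)]
  gcongr
  exact h.abs_apply_le x

theorem isClassicalSolution_of_hasDerivAt {b p ω : ℝ} {f g k l h : ℝ → ℝ}
    (h1 : ∀ x, HasDerivAt f (g x) x) (h2 : ∀ x, HasDerivAt g (k x) x)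
    (h3 : ∀ x, HasDerivAt k (l x) x) (h4 : ∀ x, HasDerivAt l (h x) x) (hc : Continuous h)
    (he : ∀ x, h x = |f x| ^ (p - 1) * f x - ω * f x - b * k x) :
    IsClassicalSolution b p ω f := by
  have d1 : deriv f = g := funext fun x => (h1 x).deriv
  have d2 : deriv g = k := funext fun x => (h2 x).deriv
  have d3 : deriv k = l := funext fun x => (h3 x).deriv
  have d4 : deriv l = h := funext fun x => (h4 x).deriv
  have step : ∀ {n : ℕ} {u v : ℝ → ℝ}, (∀ x, HasDerivAt u (v x) x) → ContDiff ℝ n v →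
      ContDiff ℝ (n + 1 : ℕ) u := by
    intro n u v huv hv
    have : deriv u = v := funext fun x => (huv x).deriv
    rw [Nat.cast_add, Nat.cast_one, contDiff_succ_iff_deriv, this]
    exact ⟨fun x => (huv x).differentiableAt, fun hn => absurd hn (by simp), hv⟩
  have c0 : ContDiff ℝ (0 : ℕ) h := contDiff_zero.2 hc
  refine ⟨step h1 (step h2 (step h3 (step h4 c0))), fun x => ?_⟩
  simp only [iteratedDeriv_succ', iteratedDeriv_zero, d1, d2, d3, d4, he]
  ring

end Kawahara

end

/-! ### Assembly of the theorem -/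

theorem theorem1 (b p : ℝ) (hp1 : 1 < p) (hp9 : p < 9) :
    ∃ lam₀ : ℝ, 0 ≤ lam₀ ∧ (p < 5 → lam₀ = 0) ∧
      ∀ lam : ℝ, lam₀ < lam →
        ∃ φ : ℝ → ℝ,
          φ ∈ Kawahara.massSphere lam ∧
          IsMinOn (Kawahara.energy b p) (Kawahara.massSphere lam) φ ∧
          Kawahara.MemH 4 φ ∧
          ∃ ω : ℝ,
            Kawahara.IsClassicalSolution b p ω φ ∧
            (0 < b → b ^ 2 / 4 < ω) ∧
            (b < 0 → 0 < ω) := by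
  open Kawahara MeasureTheory in
  obtain ⟨lam₀, h0, h5, hneg⟩ := exists_threshold b hp1
  refine ⟨lam₀, h0, h5, fun lam hlt => ?_⟩
  have hlam : 0 < lam := h0.trans_lt hlt
  obtain ⟨f, g, k, h, hm, hJ, hmin⟩ := exists_minimizer hp1 hp9 hlam (hneg lam hlt)
  set μ := (powInt p f - quadForm b f g k) / lam with hμ
  set ω := (max b 0) ^ 2 / 4 + μ with hω
  have hμ0 : 0 < μ := by
    refine div_pos ?_ hlam
    have hN := powInt_nonneg p f
    have hT := h.quadForm_nonneg b
    have h1 : 1 / (p + 1) * powInt p f ≤ 1 / 2 * powInt p f := by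
      gcongr
      linarith
    rw [shiftedEnergy] at hJ
    linarith
  have mw : MemLp (fun x => |f x| ^ (p - 1) * f x - ω * f x - b * k x) 2 :=
    ((memLp_abs_rpow_mul hp1 h).sub (h.mem₀.const_mul ω)).sub (h.mem₂.const_mul b)
  -- The weak equation, with `g` integrated by parts once more, says that `k''` is the
  -- square-integrable function in `mw`.
  obtain ⟨l, hl, hkl⟩ := exists_isPrimitive_of_second_deriv
    (h.mem₂.locallyIntegrable (by norm_num)) (mw.locallyIntegrable (by norm_num))
    (fun η hη hc => by
      have e1 := euler_lagrange_weak hp1 hlam h hm hmin hη hc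
      have e2 := h.prim₂.isWeakDeriv.2.2 η hη hc
      have hη2 := isH2_test hη hc
      have i1 := integrable_mul (memLp_abs_rpow_mul hp1 h) hη2.mem₀
      have i2 := (integrable_mul h.mem₀ hη2.mem₀).const_mul ω
      have i3 := (integrable_mul h.mem₂ hη2.mem₀).const_mul b
      have e3 : ∀ x, (|f x| ^ (p - 1) * f x - ω * f x - b * k x) * η x
        = |f x| ^ (p - 1) * f x * η x - ω * (f x * η x) - b * (k x * η x) := fun x => by ring
      simp only [e3]
      rw [integral_sub (f := fun x => |f x| ^ (p - 1) * f x * η x - ω * (f x * η x))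
        (i1.sub i2) i3, integral_sub i1 i2, integral_const_mul, integral_const_mul]
      rw [e2, ← hμ, ← hω] at e1
      linarith)
  -- The continuous representative of `k` makes the right-hand side continuous, so the equation
  -- holds at every point.
  obtain ⟨k', hk', hkk⟩ := hkl.exists_isPrimitive
  have hH : IsH2 f g k' :=
    ⟨h.prim₁, h.prim₂.congr_ae hkk.symm, h.mem₀, h.mem₁, h.mem₂.ae_eq hkk.symm⟩
  have hae : (fun x => |f x| ^ (p - 1) * f x - ω * f x - b * k x) =ᵐ[volume]
      fun x => |f x| ^ (p - 1) * f x - ω * f x - b * k' x :=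
    hkk.mono fun x hx => by simp only [hx]
  have hl' := hl.congr_ae hae
  have mw' := mw.ae_eq hae
  have ml := memLp_of_isPrimitive hk' hl' hH.mem₂ mw'
  have cw : Continuous fun x => |f x| ^ (p - 1) * f x - ω * f x - b * k' x :=
    ((continuous_abs_rpow_mul hp1 h.prim₁.continuous).sub
      (continuous_const.mul h.prim₁.continuous)).sub (continuous_const.mul hk'.continuous)
  refine ⟨f, ⟨h.memH, hm⟩, ?_, ?_, ω, ?_, fun hb => ?_, fun hb => ?_⟩
  · rw [isMinOn_iff]
    rintro φ ⟨hφ, hφm⟩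
    obtain ⟨f', g', k'', h', hae'⟩ := hφ.exists_isH2
    have hm' : ∫ x, f' x ^ 2 = lam := by
      rw [← hφm]
      exact integral_congr_ae (hae'.mono fun x hx => by simp only [hx])
    rw [energy_congr hae', h.energy_eq, h'.energy_eq, hm, hm']
    linarith [hmin f' g' k'' h' hm']
  · exact ⟨hH.mem₀, g, hH.prim₁.isWeakDeriv, hH.mem₁, k', hH.prim₂.isWeakDeriv, hH.mem₂, l,
      hk'.isWeakDeriv, ml, _, hl'.isWeakDeriv, mw'⟩
  · exact isClassicalSolution_of_hasDerivAt hH.hasDerivAt (hH.prim₂.hasDerivAt hk'.continuous)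
      (hk'.hasDerivAt hl'.continuous) (hl'.hasDerivAt cw) cw fun x => rfl
  · rw [hω, max_eq_left hb.le]
    linarith
  · rw [hω, max_eq_right hb.le]
    linarith
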